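/- Let $n\ge 0$ be an integer and let $\mathbb R_n$ be the real Clifford algebra with units $e_1,\dots,e_n$ ($e_i^2=-1$, $e_ie_j=-e_je_i$ for $i\ne j$), with basis $e_A=e_{i_1}\cdots e_{i_r}$ for $A=\{i_1<\dots<i_r\}$ and norm $\|\sum_A y_Ae_A\|^2=\sum_A|y_A|^2$; let $\mathbb R^{n+1}$ carry the Euclidean norm. Let $f:\mathbb R^{n+1}\to\mathbb R_n$ be an entire left monogenic function, that is, $f$ is of class $C^1$ and $\partial_{x_0}f+\sum_{i=1}^n e_i\,\partial_{x_i}f=0$ on $\mathbb R^{n+1}$. Let $$f(x)=\sum_{q=0}^{\infty}P_q(x),\qquad P_q(x)=\sum_{|m|=q}V_m(x)\,a_m\qquad(x\in\mathbb R^{n+1})$$ be its Taylor expansion, where $m$ runs over the multi-indices in $\mathbb N_0^n$, $a_m\in\mathbb R_n$, and $$V_m(x)=\frac{m!}{|m|!}\sum_{w}z_{w(1)}\cdots z_{w(|m|)},\qquad z_i=x_i-x_0e_i,$$ are the Fueter polynomials, the sum being over all distinguishable arrangements $w$ of the multiset that contains each index $i\in\{1,\dots,n\}$ exactly $m_i$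 times. Let $\rho>0$ and let $\rho(r)$ be a proximate order for the order $\rho$, that is, a differentiable function $\rho(r)\ge 0$ on $[0,\infty)$ with $\lim_{r\to\infty}\rho(r)=\rho$ and $\lim_{r\to\infty}\rho'(r)\,r\ln r=0$. Let $\hat\rho(r)$ be a normalization of it, that is, a proximate order for the same order $\rho$ such that $\hat\rho(r)=\rho(r)$ for all sufficiently large $r$ and such that $r\mapsto r^{\hat\rho(r)}$ is a strictly increasing map of $(0,\infty)$ onto $(0,\infty)$, and let $\varphi:(0,\infty)\to(0,\infty)$ be the inverse of $t=r^{\hat\rho(r)}$. Let $$\sigma=\limsup_{r\to\infty}\frac{\ln^+\big(\sup_{\|x\|\le r}\|f(x)\|\big)}{r^{\rho(r)}}\in[0,\infty]$$ be the type of $f$ with respect to $\rho(r)$, and let $K_q=\sup_{\|x\|\le 1}\|P_q(x)\|$. Then, in $[-\infty,+\infty]$, with $\ln 0=-\infty$ and $\ln\infty=+\infty$, $$\frac1\rho\ln\sigma=\limsup_{q\to\infty}\Big(\frac1q\ln K_q+\ln\varphi(q)\Big)-\frac1\rho-\frac{\ln\rho}{\rho}.$$ -/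

import Mathlib

open Filter Topology
open scoped ENNReal symmDiff

noncomputable section

namespace MonogenicGrowth

/-! ### The real Clifford algebra `ℝ_n`

A Clifford number is the family `(y_A)` of its real coordinates, indexed by the subsets `A` of the
index set, with the Euclidean norm `|y|² = ∑_A |y_A|²`. -/

/-- Clifford numbers `y = ∑_A y_A e_A`. -/
def Cl (n : ℕ) : Type := EuclideanSpace ℝ (Finset (Fin n))

instance (n : ℕ) : NormedAddCommGroup (Cl n) :=
  inferInstanceAs (NormedAddCommGroup (EuclideanSpace ℝ (Finset (Fin n))))

instance (n : ℕ) : InnerProductSpace ℝ (Cl n) :=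
  inferInstanceAs (InnerProductSpace ℝ (EuclideanSpace ℝ (Finset (Fin n))))

instance (n : ℕ) : FiniteDimensional ℝ (Cl n) :=
  inferInstanceAs (FiniteDimensional ℝ (EuclideanSpace ℝ (Finset (Fin n))))

namespace Cl

variable {n : ℕ}

/-- The coordinate `y_A`. -/
def coord (y : Cl n) (A : Finset (Fin n)) : ℝ := WithLp.ofLp y A

/-- The Clifford number with given coordinates. -/
def ofCoord (c : Finset (Fin n) → ℝ) : Cl n := WithLp.toLp 2 c

@[simp] theorem coord_ofCoord (c : Finset (Fin n) → ℝ) (A : Finset (Fin n)) :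
    (ofCoord c).coord A = c A := rfl

@[ext] theorem ext {x y : Cl n} (h : ∀ A, x.coord A = y.coord A) : x = y :=
  PiLp.ext h

@[simp] theorem coord_add (x y : Cl n) (A : Finset (Fin n)) :
    (x + y).coord A = x.coord A + y.coord A := rfl

@[simp] theorem coord_neg (x : Cl n) (A : Finset (Fin n)) : (-x).coord A = -x.coord A := rfl

@[simp] theorem coord_zero (A : Finset (Fin n)) : (0 : Cl n).coord A = 0 := rfl

@[simp] theorem coord_smul (c : ℝ) (x : Cl n) (A : Finset (Fin n)) :
    (c • x).coord A = c * x.coord A := rfl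

theorem norm_sq_eq (x : Cl n) : ‖x‖ ^ 2 = ∑ A, |x.coord A| ^ 2 :=
  EuclideanSpace.norm_sq_eq (𝕜 := ℝ) (n := Finset (Fin n)) x

/-- The sign in `e_A e_B = ± e_{A ∆ B}`: a factor `-1` for each pair `i ∈ A`, `j ∈ B` with `j < i`
(the two units have to be interchanged) or `j = i` (the square of a unit is `-1`). -/
def sgn (A B : Finset (Fin n)) : ℝ := ∏ i ∈ A, ∏ j ∈ B, if j ≤ i then -1 else 1

theorem prod_symmDiff_sign (A B : Finset (Fin n)) (g : Fin n → ℝ) (hg : ∀ i, g i * g i = 1) :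
    ∏ i ∈ A ∆ B, g i = (∏ i ∈ A, g i) * ∏ i ∈ B, g i := by
  have h : ∀ S : Finset (Fin n), ∏ i ∈ S, g i = ∏ i, if i ∈ S then g i else 1 := by
    intro S; simp
  rw [h, h A, h B, ← Finset.prod_mul_distrib]
  refine Finset.prod_congr rfl fun i _ => ?_
  by_cases hA : i ∈ A <;> by_cases hB : i ∈ B <;> simp [Finset.mem_symmDiff, hA, hB, hg]

theorem sgn_symmDiff_left (A B C : Finset (Fin n)) : sgn (A ∆ B) C = sgn A C * sgn B C := by
  refine prod_symmDiff_sign A B _ fun i => ?_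
  rw [← Finset.prod_mul_distrib]
  refine Finset.prod_eq_one fun j _ => ?_
  split_ifs <;> norm_num

theorem sgn_symmDiff_right (A B C : Finset (Fin n)) : sgn A (B ∆ C) = sgn A B * sgn A C := by
  unfold sgn
  rw [← Finset.prod_mul_distrib]
  refine Finset.prod_congr rfl fun i _ => prod_symmDiff_sign B C _ fun j => ?_
  split_ifs <;> norm_num

/-- The bilinear product with `e_A e_B = sgn A B • e_{A ∆ B}`. -/
instance : Mul (Cl n) :=
  ⟨fun x y => ofCoord fun C => ∑ A, sgn A (A ∆ C) * x.coord A * y.coord (A ∆ C)⟩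

theorem coord_mul (x y : Cl n) (C : Finset (Fin n)) :
    (x * y).coord C = ∑ A, sgn A (A ∆ C) * x.coord A * y.coord (A ∆ C) := rfl

/-- The basis element `e_A`. -/
def blade (A : Finset (Fin n)) : Cl n := ofCoord fun B => if B = A then 1 else 0

theorem coord_blade (A B : Finset (Fin n)) : (blade A).coord B = if B = A then 1 else 0 := rfl

instance : One (Cl n) := ⟨blade ∅⟩

theorem one_def : (1 : Cl n) = blade ∅ := rfl

theorem coord_blade_mul (A : Finset (Fin n)) (y : Cl n) (C : Finset (Fin n)) :
    (blade A * y).coord C = sgn A (A ∆ C) * y.coord (A ∆ C) := by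
  simp [coord_mul, coord_blade]

theorem blade_mul_blade (A B : Finset (Fin n)) :
    blade A * blade B = sgn A B • blade (A ∆ B) := by
  ext C
  have h : A ∆ C = B ↔ C = A ∆ B := by
    constructor
    · rintro rfl; simp [symmDiff_symmDiff_cancel_left]
    · rintro rfl; simp [symmDiff_symmDiff_cancel_left]
  rw [coord_blade_mul, coord_smul, coord_blade, coord_blade]
  by_cases hC : C = A ∆ B
  · have := h.2 hC
    simp [hC]
  · simp [hC, h]

instance : Ring (Cl n) :=
  { (inferInstance : AddCommGroup (Cl n)) with
    mul := (· * ·)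
    one := 1
    left_distrib := fun x y z => by
      ext C; simp only [coord_mul, coord_add, ← Finset.sum_add_distrib]
      exact Finset.sum_congr rfl fun A _ => by ring
    right_distrib := fun x y z => by
      ext C; simp only [coord_mul, coord_add, ← Finset.sum_add_distrib]
      exact Finset.sum_congr rfl fun A _ => by ring
    zero_mul := fun x => by ext C; simp [coord_mul]
    mul_zero := fun x => by ext C; simp [coord_mul]
    one_mul := fun x => by
      ext C
      rw [one_def, coord_blade_mul]
      rw [show (∅ : Finset (Fin n)) ∆ C = C from bot_symmDiff C]
      simp [sgn]
    mul_one := fun x => by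
      ext C
      rw [coord_mul, Finset.sum_eq_single C]
      · simp [one_def, coord_blade, sgn]
      · intro A _ hA
        have : A ∆ C ≠ ∅ := by
          rw [← Finset.bot_eq_empty]; exact fun h => hA (symmDiff_eq_bot.1 h)
        simp [one_def, coord_blade, this]
      · simp
    mul_assoc := fun x y z => by
      ext D
      simp only [coord_mul, Finset.mul_sum, Finset.sum_mul]
      rw [Finset.sum_comm]
      refine Finset.sum_congr rfl fun A _ => ?_
      refine Fintype.sum_equiv (symmDiff_right_involutive A).toPerm _ _ fun C => ?_
      obtain ⟨B, rfl⟩ : ∃ B, C = A ∆ B := ⟨A ∆ C, by simp⟩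
      simp only [Function.Involutive.coe_toPerm, symmDiff_symmDiff_cancel_left]
      have h1 : A ∆ B ∆ D = B ∆ (A ∆ D) := by
        rw [symmDiff_comm A B, symmDiff_assoc]
      have h2 : A ∆ D = B ∆ (B ∆ (A ∆ D)) := by simp
      rw [h1, sgn_symmDiff_left]
      conv_rhs => rw [show sgn A (A ∆ D) = sgn A B * sgn A (B ∆ (A ∆ D)) by
        rw [← sgn_symmDiff_right, ← h2]]
      ring }

instance : Algebra ℝ (Cl n) :=
  Algebra.ofModule
    (fun c x y => by
      ext C; simp only [coord_mul, coord_smul, Finset.mul_sum]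
      exact Finset.sum_congr rfl fun A _ => by ring)
    (fun c x y => by
      ext C; simp only [coord_mul, coord_smul, Finset.mul_sum]
      exact Finset.sum_congr rfl fun A _ => by ring)

/-- The imaginary unit `e_i`. -/
def e (i : Fin n) : Cl n := blade {i}

theorem e_mul_self (i : Fin n) : e i * e i = -1 := by
  rw [e, blade_mul_blade, symmDiff_self]
  simp [sgn, one_def]

theorem e_anticomm {i j : Fin n} (h : i ≠ j) : e i * e j + e j * e i = 0 := by
  rw [e, e, blade_mul_blade, blade_mul_blade, symmDiff_comm ({j} : Finset (Fin n)),
    ← add_smul]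
  rcases lt_or_gt_of_ne h with h | h <;> simp [sgn, h.le, not_le.2 h]

/-- `e_A = e_{i_1} ⋯ e_{i_r}` for `A = {i_1 < ⋯ < i_r}`. -/
theorem blade_eq_prod (A : Finset (Fin n)) : blade A = ((A.sort (· ≤ ·)).map e).prod := by
  induction A using Finset.induction_on_min with
  | empty => simp [one_def]
  | insert a s ha ih =>
    have hs : a ∉ s := fun h => lt_irrefl _ (ha a h)
    rw [Finset.sort_insert _ (fun b hb => (ha b hb).le) hs, List.map_cons, List.prod_cons, ← ih, e,
      blade_mul_blade]
    have h1 : sgn {a} s = 1 := by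
      unfold sgn
      rw [Finset.prod_singleton]
      exact Finset.prod_eq_one fun j hj => if_neg (not_le.2 (ha j hj))
    have h2 : ({a} : Finset (Fin n)) ∆ s = insert a s := by
      ext b
      simp only [Finset.mem_symmDiff, Finset.mem_singleton, Finset.mem_insert]
      constructor
      · tauto
      · rintro (rfl | h)
        · tauto
        · exact Or.inr ⟨h, fun h' => hs (h' ▸ h)⟩
    rw [h1, h2, one_smul]

/-- The quadratic form `v ↦ -∑ v_i²`. -/
abbrev negSq (n : ℕ) : QuadraticForm ℝ (Fin n → ℝ) :=
  QuadraticMap.weightedSumSquares ℝ fun _ : Fin n => (-1 : ℝ)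

/-- `∑ v_i e_i`. -/
def vec (n : ℕ) : (Fin n → ℝ) →ₗ[ℝ] Cl n := Fintype.linearCombination ℝ e

theorem vec_apply (v : Fin n → ℝ) : vec n v = ∑ i, v i • e i := rfl

theorem vec_mul_self (v : Fin n → ℝ) :
    vec n v * vec n v = algebraMap ℝ (Cl n) (negSq n v) := by
  have key : vec n v * vec n v + vec n v * vec n v
      = algebraMap ℝ (Cl n) (negSq n v) + algebraMap ℝ (Cl n) (negSq n v) := by
    have h1 : vec n v * vec n v = ∑ i, ∑ j, (v i * v j) • (e i * e j) := by
      rw [vec_apply, Finset.sum_mul_sum]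
      exact Finset.sum_congr rfl fun i _ => Finset.sum_congr rfl fun j _ => by
        rw [smul_mul_smul_comm]
    have h2 : vec n v * vec n v = ∑ i, ∑ j, (v i * v j) • (e j * e i) := by
      rw [h1, Finset.sum_comm]
      exact Finset.sum_congr rfl fun i _ => Finset.sum_congr rfl fun j _ => by
        rw [mul_comm (v j)]
    nth_rewrite 1 [h1]
    rw [h2, ← Finset.sum_add_distrib, QuadraticMap.weightedSumSquares_apply, map_sum,
      ← Finset.sum_add_distrib]
    refine Finset.sum_congr rfl fun i _ => ?_
    rw [← Finset.sum_add_distrib, Finset.sum_eq_single i]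
    · rw [e_mul_self, Algebra.algebraMap_eq_smul_one]
      simp
    · intro j _ hj
      rw [← smul_add, e_anticomm (Ne.symm hj), smul_zero]
    · simp
  rw [← two_smul ℝ, ← two_smul ℝ] at key
  exact smul_right_injective _ (two_ne_zero' ℝ) key

/-- The algebra homomorphism from Mathlib's Clifford algebra that sends `v` to `∑ v_i e_i`. -/
def ofCliffordAlgebra (n : ℕ) : CliffordAlgebra (negSq n) →ₐ[ℝ] Cl n :=
  CliffordAlgebra.lift (negSq n) ⟨vec n, vec_mul_self⟩

/-- `Cl n` is the Clifford algebra of `v ↦ -∑ v_i²`. -/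
theorem ofCliffordAlgebra_bijective (n : ℕ) : Function.Bijective (ofCliffordAlgebra n) := by
  have he : ∀ i, e i ∈ (ofCliffordAlgebra n).range := fun i =>
    ⟨CliffordAlgebra.ι _ (Pi.single i 1), by
      simp [ofCliffordAlgebra, vec_apply, Pi.single_apply]⟩
  have hs : Function.Surjective (ofCliffordAlgebra n).toLinearMap := by
    intro y
    have hy : y = ∑ A, y.coord A • blade A := by
      have hc : ∀ (s : Finset (Finset (Fin n))) (B : Finset (Fin n)),
          (∑ A ∈ s, y.coord A • blade A).coord B = ∑ A ∈ s, (y.coord A • blade A).coord B := by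
        intro s B
        induction s using Finset.induction_on with
        | empty => simp
        | insert a s ha ih => rw [Finset.sum_insert ha, Finset.sum_insert ha, coord_add, ih]
      ext B
      rw [hc]
      simp [coord_blade]
    have : y ∈ (ofCliffordAlgebra n).range := by
      rw [hy]
      refine Subalgebra.sum_mem _ fun A _ => Subalgebra.smul_mem _ ?_ _
      rw [blade_eq_prod]
      refine Subalgebra.list_prod_mem _ fun x hx => ?_
      obtain ⟨i, _, rfl⟩ := List.mem_map.1 hx
      exact he i
    exact this
  let b := (Pi.basisFun ℝ (Fin n)).ExteriorAlgebra.map (CliffordAlgebra.equivExterior (negSq n)).symm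
  have : FiniteDimensional ℝ (CliffordAlgebra (negSq n)) := b.finiteDimensional_of_finite
  have hd : Module.finrank ℝ (CliffordAlgebra (negSq n)) = Module.finrank ℝ (Cl n) := by
    rw [Module.finrank_eq_card_basis b]
    exact (finrank_euclideanSpace (𝕜 := ℝ) (ι := Finset (Fin n))).symm
  exact ⟨(LinearMap.injective_iff_surjective_of_finrank_eq_finrank hd).2 hs, hs⟩

end Cl

/-! ### Entire left monogenic functions and Fueter polynomials

The point `(x_0, …, x_n)` of `ℝ^{n+1}` is `x : EuclideanSpace ℝ (Fin (n + 1))`. -/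

/-- The partial derivative `∂f/∂x_j` at `x`. -/
def partialDeriv {n : ℕ} (j : Fin (n + 1)) (f : EuclideanSpace ℝ (Fin (n + 1)) → Cl n)
    (x : EuclideanSpace ℝ (Fin (n + 1))) : Cl n :=
  fderiv ℝ f x (EuclideanSpace.single j 1)

/-- `f` is of class `C¹` on `ℝ^{n+1}` and `∂_{x_0} f + ∑ e_i ∂_{x_i} f = 0`. -/
def IsLeftMonogenic {n : ℕ} (f : EuclideanSpace ℝ (Fin (n + 1)) → Cl n) : Prop :=
  ContDiff ℝ 1 f ∧
    ∀ x, partialDeriv 0 f x + ∑ i : Fin n, Cl.e i * partialDeriv i.succ f x = 0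

/-- The hypercomplex variable `z_i = x_i - x_0 e_i`. -/
def fueterVar {n : ℕ} (i : Fin n) (x : EuclideanSpace ℝ (Fin (n + 1))) : Cl n :=
  x i.succ • (1 : Cl n) - x 0 • Cl.e i

/-- The Fueter polynomial `V_m = (m! / |m|!) ∑ z_{w(1)} ⋯ z_{w(|m|)}`, the sum being over the
distinguishable arrangements `w` of the multiset that contains each index `i` exactly `m_i` times. -/
def fueterPoly {n : ℕ} (m : Fin n → ℕ) (x : EuclideanSpace ℝ (Fin (n + 1))) : Cl n :=
  ((∏ i, ((m i).factorial : ℝ)) / ((∑ i, m i).factorial : ℝ)) •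
    ∑ w : Fin (∑ i, m i) → Fin n with ∀ i, (Finset.univ.filter fun k => w k = i).card = m i,
      (List.ofFn fun k => fueterVar (w k) x).prod

/-- `P_q(x) = ∑_{|m| = q} V_m(x) a_m`. -/
def homPart {n : ℕ} (a : (Fin n → ℕ) → Cl n) (q : ℕ) (x : EuclideanSpace ℝ (Fin (n + 1))) :
    Cl n :=
  ∑ m ∈ Finset.Nat.antidiagonalTuple n q, fueterPoly m x * a m

/-- `K_q`, the supremum of `‖P_q(x)‖` over `‖x‖ ≤ 1`. -/
def homSup {n : ℕ} (a : (Fin n → ℕ) → Cl n) (q : ℕ) : ℝ≥0∞ :=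
  ⨆ x ∈ Metric.closedBall (0 : EuclideanSpace ℝ (Fin (n + 1))) 1, ‖homPart a q x‖ₑ

/-! ### Proximate orders and the type -/

/-- The function `p` on `[0, ∞)` is a proximate order for the order `ρ`. -/
structure IsProximateOrder (ρ : ℝ) (p : ℝ → ℝ) : Prop where
  differentiableOn : DifferentiableOn ℝ p (Set.Ici 0)
  nonneg : ∀ r, 0 ≤ r → 0 ≤ p r
  tendsto : Tendsto p atTop (𝓝 ρ)
  tendsto_deriv : Tendsto (fun r => deriv p r * r * Real.log r) atTop (𝓝 0)

/-- `p'` is a normalization of the proximate order `p` for the order `ρ`. -/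
structure IsNormalization (ρ : ℝ) (p p' : ℝ → ℝ) : Prop where
  isProximateOrder : IsProximateOrder ρ p'
  eventually_eq : ∃ r₁ > 0, ∀ r, r₁ ≤ r → p' r = p r
  strictMonoOn : StrictMonoOn (fun r => r ^ p' r) (Set.Ioi 0)
  bijOn : Set.BijOn (fun r => r ^ p' r) (Set.Ioi 0) (Set.Ioi 0)

/-- The inverse `φ` of the function `t = r ^ p'(r)` of `(0, ∞)` onto `(0, ∞)`. -/
def inverseFn (p' : ℝ → ℝ) : ℝ → ℝ :=
  Function.invFunOn (fun r => r ^ p' r) (Set.Ioi 0)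

/-- The supremum of `‖f(x)‖` over `‖x‖ ≤ r`. -/
def maxModulus {n : ℕ} (f : EuclideanSpace ℝ (Fin (n + 1)) → Cl n) (r : ℝ) : ℝ≥0∞ :=
  ⨆ x ∈ Metric.closedBall (0 : EuclideanSpace ℝ (Fin (n + 1))) r, ‖f x‖ₑ

/-- The type of `f` with respect to `p`: the upper limit of `log⁺ M(r, f) / r ^ p(r)` as `r → ∞`.
Here `EReal.toENNReal` turns `log` into `log⁺`. -/
def growthType {n : ℕ} (p : ℝ → ℝ) (f : EuclideanSpace ℝ (Fin (n + 1)) → Cl n) : ℝ≥0∞ :=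
  limsup (fun r : ℝ => (ENNReal.log (maxModulus f r)).toENNReal / ENNReal.ofReal (r ^ p r)) atTop

end MonogenicGrowth

end

/-! The formula compares two families of bounds: `‖f‖ ≤ exp (A r^ρ(r))` on balls of large radius,
and `K_q ≤ exp (q (ℓ - ln φ(q)))` for large `q`. Up to arbitrarily small losses they are equivalent
when `A = exp (ρ ℓ - 1) / ρ`, and solving for `ℓ` gives the theorem.

From coefficients to growth (`eventually_norm_le`), the term `r^q K_q` is at most `exp (q (ℓ + ln r
- ln φ(q)))`. Since `r^ρ(r)` varies like a power of exponent `ρ`, maximizing over `q` gives the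
exponent `A r^ρ(r)` (`IsNormalization.eventually_mul_le`). A slightly larger `ℓ` supplies a
convergent geometric series.

From growth to coefficients (`eventually_norm_homPart_le`), one needs `‖P_q(x)‖ (s r)^q ≤ C M(r)`
for `‖x‖ ≤ 1`, with `C` depending on `n` and `s < 1` but not on `q`
(`exists_norm_homPart_mul_pow_le`). It is used at the optimal radius `r = φ(q / (A ρ))`.

That estimate reduces to one complex variable. A Cauchy–Pompeiu formula with a cutoff
(`cauchy_pompeiu`) expresses `f(t x)`, for real `t` and a unit vector `x`, as an integral over an
annulus of a kernel whose denominator is a power of `‖y‖² - 2t⟨y,x⟩ + t²`. This quadratic stays in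
the slit plane for complex `|t| < ‖y‖`, so `t ↦ f(t x) = ∑ t^q P_q(x)` extends to a bounded
holomorphic function on a disc, componentwise, and the classical Cauchy estimate bounds `P_q(x)`. -/

/-! ### One complex variable -/

/-- The imaginary part `2 Im t (Re t - c)` vanishes only if `t` is real or `Re t = c`; the real part
is then `(r² - c²) + (t - c)²`, respectively `r² - |t|²`, and is positive. Used with `r = ‖y‖`, `c =
⟨y, x⟩`. -/
theorem Complex.quadratic_mem_slitPlane {c r : ℝ} (hc : |c| ≤ r) {t : ℂ} (ht : ‖t‖ < r) :
    ((r ^ 2 : ℝ) : ℂ) - 2 * t * c + t ^ 2 ∈ Complex.slitPlane := by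
  have hr : 0 < r := lt_of_le_of_lt (norm_nonneg _) ht
  have h1 : t.re ^ 2 + t.im ^ 2 < r ^ 2 := by
    have h2 := Complex.sq_norm t
    rw [Complex.normSq_apply] at h2
    nlinarith [norm_nonneg t]
  have hc2 : c ^ 2 ≤ r ^ 2 := sq_le_sq' (by linarith [neg_abs_le c]) (by linarith [le_abs_self c])
  rw [Complex.mem_slitPlane_iff]
  have him : (((r ^ 2 : ℝ) : ℂ) - 2 * t * c + t ^ 2).im = 2 * t.im * (t.re - c) := by
    simp [pow_two]; ring
  have hre : (((r ^ 2 : ℝ) : ℂ) - 2 * t * c + t ^ 2).re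
      = r ^ 2 - 2 * t.re * c + (t.re ^ 2 - t.im ^ 2) := by
    simp [pow_two]
  rw [him, hre]
  by_cases h : 2 * t.im * (t.re - c) = 0
  · left
    rcases mul_eq_zero.1 h with h' | h'
    · have h0 : t.im = 0 := by linarith
      rw [h0] at h1 ⊢
      have : 0 ≤ (t.re - c) ^ 2 := sq_nonneg _
      rcases eq_or_lt_of_le hc2 with he | hl
      · by_contra hcon
        have h3 : (t.re - c) ^ 2 = 0 := by nlinarith
        have h4 : t.re = c := by nlinarith [pow_eq_zero_iff (two_ne_zero) |>.1 h3]
        rw [h4] at h1; nlinarith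
      · nlinarith
    · have h0 : t.re = c := by linarith
      rw [h0] at h1 ⊢
      nlinarith
  · exact Or.inr h

/-- The quadratic factors as `(w - t)(w̄ - t)` with `|w| = r` and `Re w = c`. -/
theorem Complex.sq_le_norm_quadratic {c r : ℝ} (hc : |c| ≤ r) {t : ℂ} (ht : ‖t‖ ≤ r) :
    (r - ‖t‖) ^ 2 ≤ ‖((r ^ 2 : ℝ) : ℂ) - 2 * t * c + t ^ 2‖ := by
  have hc2 : c ^ 2 ≤ r ^ 2 := sq_le_sq' (by linarith [neg_abs_le c]) (by linarith [le_abs_self c])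
  have hr : 0 ≤ r := (abs_nonneg c).trans hc
  set w : ℂ := ⟨c, √(r ^ 2 - c ^ 2)⟩ with hw
  have hs : √(r ^ 2 - c ^ 2) ^ 2 = r ^ 2 - c ^ 2 := Real.sq_sqrt (by linarith)
  have hwn : ‖w‖ = r := by
    rw [Complex.norm_def, Complex.normSq_apply]
    rw [show w.re * w.re + w.im * w.im = r ^ 2 by simp only [hw]; nlinarith]
    exact Real.sqrt_sq hr
  have hfac : ((r ^ 2 : ℝ) : ℂ) - 2 * t * c + t ^ 2 = (w - t) * (starRingEnd ℂ w - t) := by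
    have h1 : w * starRingEnd ℂ w = ((r ^ 2 : ℝ) : ℂ) := by
      rw [Complex.mul_conj, Complex.normSq_eq_norm_sq, hwn]
    have h2 : w + starRingEnd ℂ w = 2 * (c : ℂ) := by
      rw [Complex.add_conj]; simp [hw]
    rw [← h1]; linear_combination t * h2
  rw [hfac, norm_mul, pow_two]
  have h1 : r - ‖t‖ ≤ ‖w - t‖ := hwn ▸ norm_sub_norm_le w t
  have h2 : r - ‖t‖ ≤ ‖starRingEnd ℂ w - t‖ := by
    have := norm_sub_norm_le (starRingEnd ℂ w) t
    rwa [Complex.norm_conj, hwn] at this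
  exact mul_le_mul h1 h2 (by linarith) (norm_nonneg _)

/-- A bounded family of holomorphic functions on a disc may be integrated over a finite measure. -/
theorem Complex.differentiableOn_integral_of_bounded {α : Type*} [MeasurableSpace α]
    {μ : MeasureTheory.Measure α} [MeasureTheory.IsFiniteMeasure μ] {F : ℂ → α → ℂ} {R B : ℝ}
    (hm : ∀ t ∈ Metric.ball (0 : ℂ) R, MeasureTheory.AEStronglyMeasurable (F t) μ)
    (hb : ∀ t ∈ Metric.ball (0 : ℂ) R, ∀ y, ‖F t y‖ ≤ B)
    (hd : ∀ y, DifferentiableOn ℂ (fun t => F t y) (Metric.ball 0 R)) :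
    DifferentiableOn ℂ (fun t => ∫ y, F t y ∂μ) (Metric.ball 0 R) := by
  intro t₀ ht₀
  obtain ⟨ε, hε, hball⟩ : ∃ ε > 0, Metric.ball t₀ (2 * ε) ⊆ Metric.ball (0 : ℂ) R := by
    obtain ⟨ε, hε, h⟩ := Metric.isOpen_iff.1 Metric.isOpen_ball t₀ ht₀
    exact ⟨ε / 2, by positivity, by rwa [show 2 * (ε / 2) = ε by ring]⟩
  have hmem : ∀ t ∈ Metric.ball t₀ ε, t ∈ Metric.ball (0 : ℂ) R := fun t ht =>
    hball (Metric.ball_subset_ball (by linarith) ht)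
  have hderiv : ∀ y, ∀ t ∈ Metric.ball (0 : ℂ) R,
      HasDerivAt (fun t => F t y) (deriv (fun t => F t y) t) t := fun y t ht =>
    ((hd y).differentiableAt (Metric.isOpen_ball.mem_nhds ht)).hasDerivAt
  refine (hasDerivAt_integral_of_dominated_loc_of_deriv_le (F := F)
    (F' := fun t y => deriv (fun t => F t y) t) (bound := fun _ => B / (ε / 2))
    (Metric.ball_mem_nhds t₀ hε) ?_ ?_ ?_ ?_ ?_ ?_).2.differentiableAt.differentiableWithinAt
  · filter_upwards [Metric.ball_mem_nhds t₀ hε] with t ht using hm t (hmem t ht)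
  · exact (MeasureTheory.integrable_const B).mono' (hm _ ht₀) (Eventually.of_forall (hb _ ht₀))
  -- The derivative is measurable in `y` as a limit of difference quotients along a sequence; the
  -- shift by `N` keeps the sequence inside the disc.
  · obtain ⟨u, hu⟩ : ∃ u : ℕ → ℂ, Tendsto u atTop (𝓝[≠] t₀) := exists_seq_tendsto _
    have hev : ∀ᶠ k in atTop, u k ∈ Metric.ball (0 : ℂ) R :=
      (tendsto_nhdsWithin_iff.1 hu).1 (Metric.isOpen_ball.mem_nhds ht₀)
    obtain ⟨N, hN⟩ := eventually_atTop.1 hev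
    refine aestronglyMeasurable_of_tendsto_ae atTop
      (f := fun k y => slope (fun t => F t y) t₀ (u (k + N))) (fun k => ?_) ?_
    · simp only [slope, vsub_eq_sub]
      exact ((hm (u (k + N)) (hN _ (Nat.le_add_left N k))).sub (hm _ ht₀)).const_smul
        ((u (k + N) - t₀)⁻¹)
    · refine Eventually.of_forall fun y => ?_
      exact (hasDerivAt_iff_tendsto_slope.1 (hderiv y t₀ ht₀)).comp
        (hu.comp (tendsto_add_atTop_nat N))
  -- Cauchy's estimate on the disc of radius `ε / 2` around `t` gives the dominating constant.
  · refine Eventually.of_forall fun y t ht => ?_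
    have hsub : Metric.closedBall t (ε / 2) ⊆ Metric.ball (0 : ℂ) R := by
      intro z hz
      refine hball ?_
      rw [Metric.mem_closedBall] at hz
      rw [Metric.mem_ball] at ht ⊢
      linarith [dist_triangle z t t₀]
    refine Complex.norm_deriv_le_of_forall_mem_sphere_norm_le (by positivity) ?_
      fun z hz => hb z (hsub (Metric.sphere_subset_closedBall hz)) y
    refine DifferentiableOn.diffContOnCl ?_
    rw [closure_ball _ (by positivity)]
    exact (hd y).mono hsub
  · exact MeasureTheory.integrable_const _
  · exact Eventually.of_forall fun y t ht => hderiv y t (hmem t ht)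

/-- Cauchy's estimate for a real power series whose sum extends to a bounded holomorphic function
on a disc. -/
theorem Complex.abs_coeff_mul_pow_le {p : ℕ → ℝ} {g : ℝ → ℝ} {h : ℂ → ℂ} {R B s : ℝ}
    (hsum : ∀ t : ℝ, HasSum (fun q => t ^ q * p q) (g t))
    (hh : DifferentiableOn ℂ h (Metric.ball 0 R))
    (hb : ∀ t ∈ Metric.ball (0 : ℂ) R, ‖h t‖ ≤ B)
    (heq : ∀ t : ℝ, |t| < R → h t = g t) (hs : 0 < s) (hsR : s < R) (q : ℕ) :
    |p q| * s ^ q ≤ B := by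
  let P : FormalMultilinearSeries ℂ ℂ ℂ := fun k =>
    ContinuousMultilinearMap.mkPiRing ℂ (Fin k) ((p k : ℝ) : ℂ)
  have hPn : ∀ k, ‖P k‖ = |p k| := fun k => by simp [P]
  have hrad : P.radius = ⊤ := by
    refine ENNReal.eq_top_of_forall_nnreal_le fun r => P.le_radius_of_summable ?_
    have := (hsum r).summable.norm
    refine this.congr fun k => ?_
    rw [hPn]; simp [mul_comm]
  have hP : HasFPowerSeriesOnBall P.sum P 0 P.radius :=
    P.hasFPowerSeriesOnBall (by simp [hrad])
  have hR : 0 < R := hs.trans hsR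
  have hGan : AnalyticOnNhd ℂ P.sum (Metric.ball 0 R) := fun z _ =>
    hP.analyticOnNhd z (by simp [hrad])
  have hhan : AnalyticOnNhd ℂ h (Metric.ball 0 R) := hh.analyticOnNhd Metric.isOpen_ball
  have hreal : ∀ t : ℝ, |t| < R → h t = P.sum t := by
    intro t ht
    rw [heq t ht, FormalMultilinearSeries.sum]
    have := Complex.hasSum_ofReal.2 (hsum t)
    rw [← this.tsum_eq]
    refine tsum_congr fun k => ?_
    simp [P]
  -- Agreement on real points accumulating at `0` suffices for the identity theorem.
  have hfreq : ∃ᶠ z in 𝓝[≠] (0 : ℂ), h z = P.sum z := by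
    have ht : Tendsto (fun t : ℝ => (t : ℂ)) (𝓝[≠] 0) (𝓝[≠] 0) := by
      refine tendsto_nhdsWithin_iff.2 ⟨?_, ?_⟩
      · have : Tendsto (fun t : ℝ => (t : ℂ)) (𝓝 0) (𝓝 ((0 : ℝ) : ℂ)) :=
          Complex.continuous_ofReal.tendsto 0
        exact (by simpa using this : Tendsto (fun t : ℝ => (t : ℂ)) (𝓝 0) (𝓝 0)).mono_left
          nhdsWithin_le_nhds
      · filter_upwards [self_mem_nhdsWithin] with t ht
        simpa using ht
    refine ht.frequently (Eventually.frequently ?_)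
    have : ∀ᶠ t : ℝ in 𝓝 0, |t| < R := by
      filter_upwards [Metric.ball_mem_nhds (0 : ℝ) hR] with t ht
      simpa using ht
    exact (this.filter_mono nhdsWithin_le_nhds).mono hreal
  have hEq : Set.EqOn h P.sum (Metric.ball 0 R) :=
    hhan.eqOn_of_preconnected_of_frequently_eq hGan (convex_ball _ _).isPreconnected
      (Metric.mem_ball_self hR) hfreq
  have hsub : Metric.closedBall (0 : ℂ) s ⊆ Metric.ball 0 R := Metric.closedBall_subset_ball hsR
  have hest := Complex.norm_iteratedDeriv_le_of_forall_mem_sphere_norm_le (f := P.sum)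
    (c := 0) (C := B) q hs
    (DifferentiableOn.diffContOnCl (by
      rw [closure_ball _ hs.ne']
      exact hGan.differentiableOn.mono hsub))
    (fun z hz => by
      have hz' := hsub (Metric.sphere_subset_closedBall hz)
      rw [← hEq hz']; exact hb z hz')
  have hfac := hP.factorial_smul (1 : ℂ) q
  rw [← iteratedDeriv_eq_iteratedFDeriv] at hfac
  rw [← hfac] at hest
  have hv : ‖(q.factorial • (P q fun _ => (1 : ℂ)))‖ = q.factorial * |p q| := by
    simp [P]
  rw [hv, le_div_iff₀ (by positivity)] at hest
  have : (0 : ℝ) < q.factorial := by positivity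
  nlinarith

/-! ### Clifford multiplication and paravectors -/

noncomputable section
namespace MonogenicGrowth

open MeasureTheory

namespace Cl

/-- Multiplication as a continuous bilinear map. -/
def mulL (n : ℕ) : Cl n →L[ℝ] Cl n →L[ℝ] Cl n :=
  LinearMap.toContinuousLinearMap
    ((LinearMap.toContinuousLinearMap : (Cl n →ₗ[ℝ] Cl n) ≃ₗ[ℝ] _).toLinearMap ∘ₗ
      LinearMap.mul ℝ (Cl n))

@[simp] theorem mulL_apply {n : ℕ} (x y : Cl n) : mulL n x y = x * y := rfl

theorem continuous_mul {n : ℕ} {X : Type*} [TopologicalSpace X] {u v : X → Cl n}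
    (hu : Continuous u) (hv : Continuous v) : Continuous fun x => u x * v x :=
  (mulL n).continuous₂.comp (hu.prodMk hv)

/-- The coordinate norm is not submultiplicative in general. The constant is harmless because it
does not depend on the degree `q`. -/
theorem norm_mul_le {n : ℕ} (x y : Cl n) : ‖x * y‖ ≤ ‖mulL n‖ * ‖x‖ * ‖y‖ :=
  (mulL n).le_opNorm₂ x y

/-- The units `1, e_1, …, e_n`. -/
def unit {n : ℕ} (i : Fin (n + 1)) : Cl n := Fin.cases 1 e i

/-- The conjugate units `1, -e_1, …, -e_n`. -/
def conjUnit {n : ℕ} (i : Fin (n + 1)) : Cl n := Fin.cases 1 (fun j => -e j) i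

theorem conjUnit_mul_unit_self {n : ℕ} (i : Fin (n + 1)) : conjUnit i * unit i = (1 : Cl n) := by
  refine Fin.cases ?_ (fun j => ?_) i
  · simp [conjUnit, unit]
  · simp [conjUnit, unit, e_mul_self]

theorem conjUnit_mul_unit_anticomm {n : ℕ} {i j : Fin (n + 1)} (h : i ≠ j) :
    conjUnit i * unit j + conjUnit j * unit i = (0 : Cl n) := by
  revert h
  refine Fin.cases ?_ (fun i => ?_) i <;> refine Fin.cases ?_ (fun j => ?_) j <;> intro h
  · exact absurd rfl h
  · simp [conjUnit, unit]
  · simp [conjUnit, unit]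
  · have h' : i ≠ j := fun h' => h (congrArg _ h')
    have := e_anticomm (n := n) h'
    simp only [conjUnit, unit, Fin.cases_succ, neg_mul]
    rw [← neg_add, this, neg_zero]

end Cl

variable {n : ℕ}

/-- The paravector `x_0 + ∑ x_i e_i`. -/
def paravector (x : EuclideanSpace ℝ (Fin (n + 1))) : Cl n := ∑ j, x j • Cl.unit j

/-- The conjugate paravector `x_0 - ∑ x_i e_i`, as a linear function of `x`. -/
def conjL (n : ℕ) : EuclideanSpace ℝ (Fin (n + 1)) →L[ℝ] Cl n :=
  ∑ j, (EuclideanSpace.proj j : EuclideanSpace ℝ (Fin (n + 1)) →L[ℝ] ℝ).smulRight (Cl.conjUnit j)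

theorem conjL_apply (x : EuclideanSpace ℝ (Fin (n + 1))) :
    conjL n x = ∑ j, x j • Cl.conjUnit j := by
  simp [conjL]

theorem conjL_single (i : Fin (n + 1)) :
    conjL n (EuclideanSpace.single i 1) = Cl.conjUnit i := by
  rw [conjL_apply, Finset.sum_eq_single i] <;> simp +contextual

/-- Adding the double sum to itself with the indices exchanged cancels the off-diagonal terms by
anticommutation. -/
theorem conjL_mul_paravector (x : EuclideanSpace ℝ (Fin (n + 1))) :
    conjL n x * paravector x = (‖x‖ ^ 2) • (1 : Cl n) := by
  have h1 : conjL n x * paravector x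
      = ∑ i, ∑ j, (x i * x j) • (Cl.conjUnit i * Cl.unit j) := by
    rw [conjL_apply, paravector, Finset.sum_mul_sum]
    exact Finset.sum_congr rfl fun i _ => Finset.sum_congr rfl fun j _ => by
      rw [smul_mul_smul_comm]
  have h2 : conjL n x * paravector x
      = ∑ i, ∑ j, (x i * x j) • (Cl.conjUnit j * Cl.unit i) := by
    rw [h1, Finset.sum_comm]
    exact Finset.sum_congr rfl fun i _ => Finset.sum_congr rfl fun j _ => by
      rw [mul_comm (x j)]
  have key : conjL n x * paravector x + conjL n x * paravector x
      = (‖x‖ ^ 2) • (1 : Cl n) + (‖x‖ ^ 2) • (1 : Cl n) := by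
    nth_rewrite 1 [h1]
    rw [h2, ← Finset.sum_add_distrib, EuclideanSpace.norm_sq_eq, Finset.sum_smul,
      ← Finset.sum_add_distrib]
    refine Finset.sum_congr rfl fun i _ => ?_
    rw [← Finset.sum_add_distrib, Finset.sum_eq_single i]
    · simp [Cl.conjUnit_mul_unit_self, pow_two]
    · intro j _ hj
      rw [← smul_add, Cl.conjUnit_mul_unit_anticomm (Ne.symm hj), smul_zero]
    · simp
  rw [← two_smul ℝ, ← two_smul ℝ] at key
  exact smul_right_injective _ (two_ne_zero' ℝ) key

/-! ### The Cauchy–Pompeiu formula with a cutoff -/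

theorem IsLeftMonogenic.sum_unit_mul {f : EuclideanSpace ℝ (Fin (n + 1)) → Cl n}
    (hf : IsLeftMonogenic f) (x : EuclideanSpace ℝ (Fin (n + 1))) :
    ∑ i, Cl.unit i * fderiv ℝ f x (EuclideanSpace.single i 1) = 0 := by
  have := hf.2 x
  rw [Fin.sum_univ_succ]
  simpa [Cl.unit, partialDeriv] using this

/-- Integration by parts moves the operator from `φ` onto `f`, which it annihilates; compact support
removes boundary terms. -/
theorem integral_dirac_mul_eq_zero {f φ : EuclideanSpace ℝ (Fin (n + 1)) → Cl n}
    (hf : IsLeftMonogenic f) (hφ : ContDiff ℝ 1 φ) (hc : HasCompactSupport φ) :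
    ∫ y, (∑ i, fderiv ℝ φ y (EuclideanSpace.single i 1) * Cl.unit i) * f y = 0 := by
  have hfc := hf.1.continuous
  have hφc := hφ.continuous
  have hf'c : ∀ v, Continuous fun y => fderiv ℝ f y v := fun v =>
    (hf.1.continuous_fderiv one_ne_zero).clm_apply continuous_const
  have hφ'c : ∀ v, Continuous fun y => fderiv ℝ φ y v := fun v =>
    (hφ.continuous_fderiv one_ne_zero).clm_apply continuous_const
  have hφ's : ∀ v, HasCompactSupport fun y => fderiv ℝ φ y v := fun v =>
    hc.fderiv_apply (𝕜 := ℝ) v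
  have hmulL : ∀ {g h : EuclideanSpace ℝ (Fin (n + 1)) → Cl n}, HasCompactSupport g →
      HasCompactSupport fun y => g y * h y := fun {g h} hg =>
    hg.mono fun y hy => by
      simp only [Function.mem_support] at hy ⊢
      intro h0; exact hy (by rw [h0, zero_mul])
  have hint : ∀ i : Fin (n + 1), Integrable fun y =>
      fderiv ℝ φ y (EuclideanSpace.single i 1) * Cl.unit i * f y := fun i =>
    (Cl.continuous_mul (Cl.continuous_mul (hφ'c _) continuous_const) hfc).integrable_of_hasCompactSupport
      (hmulL (hmulL (hφ's _)))
  have hint2 : ∀ i : Fin (n + 1), Integrable fun y =>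
      φ y * Cl.unit i * fderiv ℝ f y (EuclideanSpace.single i 1) := fun i =>
    (Cl.continuous_mul (Cl.continuous_mul hφc continuous_const) (hf'c _)).integrable_of_hasCompactSupport
      (hmulL (hmulL hc))
  have hint3 : ∀ i : Fin (n + 1), Integrable fun y => φ y * Cl.unit i * f y := fun i =>
    (Cl.continuous_mul (Cl.continuous_mul hφc continuous_const) hfc).integrable_of_hasCompactSupport
      (hmulL (hmulL hc))
  have hparts : ∀ i : Fin (n + 1),
      ∫ y, fderiv ℝ φ y (EuclideanSpace.single i 1) * Cl.unit i * f y
        = -∫ y, φ y * Cl.unit i * fderiv ℝ f y (EuclideanSpace.single i 1) := by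
    intro i
    have := integral_bilinear_hasFDerivAt_right_eq_neg_left_of_integrable
      (μ := (volume : Measure (EuclideanSpace ℝ (Fin (n + 1)))))
      (f := φ) (f' := fderiv ℝ φ) (g := f) (g' := fderiv ℝ f)
      (v := EuclideanSpace.single i (1 : ℝ))
      (B := (Cl.mulL n).comp ((Cl.mulL n).flip (Cl.unit i)))
      (hint i) (hint2 i) (hint3 i)
      (fun x _ => (hφ.differentiable one_ne_zero x).hasFDerivAt)
      (fun x _ => (hf.1.differentiable one_ne_zero x).hasFDerivAt)
    simp only [ContinuousLinearMap.comp_apply, ContinuousLinearMap.flip_apply,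
      Cl.mulL_apply] at this
    rw [this, neg_neg]
  simp only [Finset.sum_mul]
  rw [integral_finsetSum _ fun i _ => hint i]
  simp only [hparts]
  rw [Finset.sum_neg_distrib, ← integral_finsetSum _ fun i _ => hint2 i]
  have : ∀ y, ∑ i, φ y * Cl.unit i * fderiv ℝ f y (EuclideanSpace.single i 1) = 0 := by
    intro y
    simp only [mul_assoc, ← Finset.mul_sum]
    rw [hf.sum_unit_mul, mul_zero]
  simp [this]

/-- The Clifford gradient `∑ ∂_i χ · unit_i` of a real function. -/
def cliffordGrad (χ : EuclideanSpace ℝ (Fin (n + 1)) → ℝ) (y : EuclideanSpace ℝ (Fin (n + 1))) :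
    Cl n :=
  ∑ i, fderiv ℝ χ y (EuclideanSpace.single i 1) • Cl.unit i

/-- With `N = ‖y - x‖² + δ` and `k = -(n+1)/2`, differentiating the conjugate paravector gives
`(n+1) N^k` and differentiating the power gives `-(n+1) ‖y - x‖² N^(k-1)`. For `δ = 0` these cancel
away from `x`; here `(n+1) δ N^(k-1)` survives, an approximate identity. -/
theorem dirac_regularized_kernel {χ : EuclideanSpace ℝ (Fin (n + 1)) → ℝ} (hχ : ContDiff ℝ 1 χ)
    (x y : EuclideanSpace ℝ (Fin (n + 1))) {δ : ℝ} (hδ : 0 < δ) :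
    ∑ i, fderiv ℝ (fun y => (χ y * (‖y - x‖ ^ 2 + δ) ^ (-((n : ℝ) + 1) / 2)) • conjL n (y - x)) y
        (EuclideanSpace.single i 1) * Cl.unit i
      = (‖y - x‖ ^ 2 + δ) ^ (-((n : ℝ) + 1) / 2) • (conjL n (y - x) * cliffordGrad χ y)
        + (χ y * (((n : ℝ) + 1) * δ * (‖y - x‖ ^ 2 + δ) ^ (-((n : ℝ) + 1) / 2 - 1))) •
          (1 : Cl n) := by
  set N : ℝ := ‖y - x‖ ^ 2 + δ with hN
  have hNpos : 0 < N := by positivity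
  set k : ℝ := -((n : ℝ) + 1) / 2 with hk
  have h1 : HasFDerivAt (fun y : EuclideanSpace ℝ (Fin (n + 1)) => ‖y - x‖ ^ 2 + δ)
      (2 • (innerSL ℝ (y - x))) y := by
    have := ((hasFDerivAt_id y).sub_const x).norm_sq
    simpa using this.add_const δ
  have h2 := (hχ.differentiable one_ne_zero y).hasFDerivAt.mul (h1.rpow_const (p := k)
    (Or.inl hNpos.ne'))
  have h3 := h2.smul ((conjL n).hasFDerivAt.comp y ((hasFDerivAt_id y).sub_const x))
  have h4 : ∀ i, fderiv ℝ (fun y => (χ y * (‖y - x‖ ^ 2 + δ) ^ k) • conjL n (y - x)) y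
        (EuclideanSpace.single i 1) =
      (χ y * N ^ k) • Cl.conjUnit i +
      (χ y * (k * N ^ (k - 1) * (2 * (y - x) i)) +
        N ^ k * fderiv ℝ χ y (EuclideanSpace.single i 1)) • conjL n (y - x) := by
    intro i
    have h5 := congrArg (fun T => T (EuclideanSpace.single i (1 : ℝ))) h3.fderiv
    refine Eq.trans h5 ?_
    simp [conjL_single, EuclideanSpace.inner_single_right, ← hN]
  simp only [h4, add_mul, smul_mul_assoc, Finset.sum_add_distrib, Cl.conjUnit_mul_unit_self,
    add_smul]
  have h6 : ∑ i, (χ y * (k * N ^ (k - 1) * (2 * (y - x) i))) • (conjL n (y - x) * Cl.unit i)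
      = (χ y * (k * N ^ (k - 1) * 2) * ‖y - x‖ ^ 2) • (1 : Cl n) := by
    rw [mul_smul, ← conjL_mul_paravector, paravector, Finset.mul_sum, Finset.smul_sum]
    refine Finset.sum_congr rfl fun i _ => ?_
    rw [mul_smul_comm, smul_smul]; congr 1; ring
  have h7 : ∑ i, (N ^ k * fderiv ℝ χ y (EuclideanSpace.single i 1)) •
      (conjL n (y - x) * Cl.unit i) = N ^ k • (conjL n (y - x) * cliffordGrad χ y) := by
    rw [cliffordGrad, Finset.mul_sum, Finset.smul_sum]
    refine Finset.sum_congr rfl fun i _ => ?_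
    rw [mul_smul_comm, smul_smul]
  rw [h6, h7, Finset.sum_const, Finset.card_univ, Fintype.card_fin, ← Nat.cast_smul_eq_nsmul ℝ,
    smul_smul, ← add_assoc, ← add_smul, add_comm]
  congr 2
  have h8 : N ^ k = N ^ (k - 1) * N := by
    rw [← Real.rpow_add_one hNpos.ne']; congr 1; ring
  rw [h8, show ‖y - x‖ ^ 2 = N - δ by rw [hN]; ring]
  push_cast
  rw [hk]; ring

theorem continuous_cliffordGrad {χ : EuclideanSpace ℝ (Fin (n + 1)) → ℝ} (hχ : ContDiff ℝ 1 χ) :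
    Continuous (cliffordGrad χ) := by
  unfold cliffordGrad
  exact continuous_finsetSum _ fun i _ =>
    ((hχ.continuous_fderiv one_ne_zero).clm_apply continuous_const).smul continuous_const

theorem cliffordGrad_eq_zero_of_fderiv {χ : EuclideanSpace ℝ (Fin (n + 1)) → ℝ}
    {y : EuclideanSpace ℝ (Fin (n + 1))} (h : fderiv ℝ χ y = 0) : cliffordGrad χ y = 0 := by
  simp [cliffordGrad, h]

theorem hasCompactSupport_cliffordGrad {χ : EuclideanSpace ℝ (Fin (n + 1)) → ℝ}
    (hc : HasCompactSupport χ) : HasCompactSupport (cliffordGrad χ) :=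
  (hc.fderiv (𝕜 := ℝ)).mono fun _ hy h0 => hy (cliffordGrad_eq_zero_of_fderiv h0)

/-- The regularization makes the kernel `C¹` at `y = x`, so no small ball has to be excised. -/
theorem integral_regularized_cauchy {f : EuclideanSpace ℝ (Fin (n + 1)) → Cl n}
    (hf : IsLeftMonogenic f) {χ : EuclideanSpace ℝ (Fin (n + 1)) → ℝ} (hχ : ContDiff ℝ 1 χ)
    (hc : HasCompactSupport χ) (x : EuclideanSpace ℝ (Fin (n + 1))) {δ : ℝ} (hδ : 0 < δ) :
    ∫ y, (((n : ℝ) + 1) * δ * (‖y - x‖ ^ 2 + δ) ^ (-((n : ℝ) + 1) / 2 - 1)) • (χ y • f y)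
      = -∫ y, (‖y - x‖ ^ 2 + δ) ^ (-((n : ℝ) + 1) / 2) •
          (conjL n (y - x) * cliffordGrad χ y * f y) := by
  have hpow : ∀ k : ℝ, ContDiff ℝ 1
      fun y : EuclideanSpace ℝ (Fin (n + 1)) => (‖y - x‖ ^ 2 + δ) ^ k := fun k =>
    (((contDiff_id.sub contDiff_const).norm_sq ℝ).add contDiff_const).rpow_const_of_ne
      fun y => by simp only [id]; positivity
  have hφ : ContDiff ℝ 1 fun y : EuclideanSpace ℝ (Fin (n + 1)) =>
      (χ y * (‖y - x‖ ^ 2 + δ) ^ (-((n : ℝ) + 1) / 2)) • conjL n (y - x) :=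
    (hχ.mul (hpow _)).smul ((conjL n).contDiff.comp (contDiff_id.sub contDiff_const))
  have hφc : HasCompactSupport fun y : EuclideanSpace ℝ (Fin (n + 1)) =>
      (χ y * (‖y - x‖ ^ 2 + δ) ^ (-((n : ℝ) + 1) / 2)) • conjL n (y - x) :=
    hc.mono fun y hy h0 => hy (by simp only; rw [h0, zero_mul, zero_smul])
  have key := integral_dirac_mul_eq_zero hf hφ hφc
  simp only [dirac_regularized_kernel hχ x _ hδ, add_mul (R := Cl n), smul_mul_assoc,
    one_mul] at key
  have hsub : Continuous fun y : EuclideanSpace ℝ (Fin (n + 1)) => conjL n (y - x) :=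
    (conjL n).continuous.comp (continuous_id.sub continuous_const)
  have hi1 : Integrable fun y => (‖y - x‖ ^ 2 + δ) ^ (-((n : ℝ) + 1) / 2) •
      (conjL n (y - x) * cliffordGrad χ y * f y) := by
    refine Continuous.integrable_of_hasCompactSupport ((hpow _).continuous.smul
      (Cl.continuous_mul (Cl.continuous_mul hsub (continuous_cliffordGrad hχ))
        hf.1.continuous)) ?_
    exact (hasCompactSupport_cliffordGrad hc).mono fun y hy h0 => hy (by
      simp only; rw [h0, mul_zero, zero_mul, smul_zero])
  have hi2 : Integrable fun y => (χ y * (((n : ℝ) + 1) * δ *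
      (‖y - x‖ ^ 2 + δ) ^ (-((n : ℝ) + 1) / 2 - 1))) • f y := by
    refine Continuous.integrable_of_hasCompactSupport ((hχ.continuous.mul
      (continuous_const.mul (hpow _).continuous)).smul hf.1.continuous) ?_
    exact hc.mono fun y hy h0 => hy (by simp only; rw [h0, zero_mul, zero_smul])
  rw [integral_add hi1 hi2] at key
  rw [← eq_neg_of_add_eq_zero_right key]
  refine integral_congr_ae (Eventually.of_forall fun y => ?_)
  simp only [smul_smul]
  rw [mul_comm]

/-- The mass of the mollifier in the regularized Cauchy formula. -/
def kernelMass (n : ℕ) : ℝ :=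
  ∫ v : EuclideanSpace ℝ (Fin (n + 1)),
    ((n : ℝ) + 1) * (1 + ‖v‖ ^ 2) ^ (-((n : ℝ) + 1) / 2 - 1)

theorem kernelMass_pos (n : ℕ) : 0 < kernelMass n := by
  have hint : Integrable fun v : EuclideanSpace ℝ (Fin (n + 1)) =>
      (1 + ‖v‖ ^ 2) ^ (-((n : ℝ) + 1) / 2 - 1) := by
    -- The exponent is `-(n+3)/2`, and `n + 3` exceeds the dimension `n + 1`.
    have := integrable_rpow_neg_one_add_norm_sq (E := EuclideanSpace ℝ (Fin (n + 1)))
      (μ := volume) (r := (n : ℝ) + 3) (by simp)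
    refine this.congr (Eventually.of_forall fun v => ?_)
    simp only; congr 1; ring
  have hcont : Continuous fun v : EuclideanSpace ℝ (Fin (n + 1)) =>
      ((n : ℝ) + 1) * (1 + ‖v‖ ^ 2) ^ (-((n : ℝ) + 1) / 2 - 1) :=
    continuous_const.mul ((continuous_const.add (continuous_norm.pow 2)).rpow_const
      fun v => Or.inl (show 1 + ‖v‖ ^ 2 ≠ 0 by positivity))
  refine integral_pos_of_integrable_nonneg_nonzero (x := 0) hcont (hint.const_mul _)
    (fun v => ?_) ?_
  · simp only [Pi.zero_apply]; positivity
  · simp; positivity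

/-- The decay required of an approximate identity: the profile is `O(‖v‖^(-(n+3)))`, which leaves
`‖v‖⁻²`. -/
theorem tendsto_norm_pow_mul_kernel (n : ℕ) :
    Tendsto (fun v : EuclideanSpace ℝ (Fin (n + 1)) =>
      ‖v‖ ^ (n + 1) * ((kernelMass n)⁻¹ *
        (((n : ℝ) + 1) * (1 + ‖v‖ ^ 2) ^ (-((n : ℝ) + 1) / 2 - 1))))
      (Bornology.cobounded _) (𝓝 0) := by
  have hb : Tendsto (fun v : EuclideanSpace ℝ (Fin (n + 1)) =>
      ((kernelMass n)⁻¹ * ((n : ℝ) + 1)) * (‖v‖ ^ 2)⁻¹) (Bornology.cobounded _) (𝓝 0) := by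
    have := ((tendsto_pow_atTop two_ne_zero).comp
      (tendsto_norm_cobounded_atTop (E := EuclideanSpace ℝ (Fin (n + 1))))).inv_tendsto_atTop
    simpa using this.const_mul ((kernelMass n)⁻¹ * ((n : ℝ) + 1))
  have hκ := kernelMass_pos n
  refine squeeze_zero' (Eventually.of_forall fun v => by positivity) ?_ hb
  have h1 : ∀ᶠ v : EuclideanSpace ℝ (Fin (n + 1)) in Bornology.cobounded _, 1 ≤ ‖v‖ :=
    tendsto_norm_cobounded_atTop.eventually_ge_atTop 1
  filter_upwards [h1] with v hv
  have hvpos : 0 < ‖v‖ := by linarith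
  have h2 : (1 + ‖v‖ ^ 2) ^ (-((n : ℝ) + 1) / 2 - 1)
      ≤ (‖v‖ ^ 2) ^ (-((n : ℝ) + 1) / 2 - 1) := by
    refine Real.rpow_le_rpow_of_nonpos (by positivity) (by linarith) ?_
    have : (0 : ℝ) ≤ n := Nat.cast_nonneg n
    linarith
  have h3 : (‖v‖ ^ 2) ^ (-((n : ℝ) + 1) / 2 - 1) = (‖v‖ ^ (n + 1))⁻¹ * (‖v‖ ^ 2)⁻¹ := by
    rw [← Real.rpow_natCast, ← Real.rpow_natCast, ← Real.rpow_mul hvpos.le,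
      ← Real.rpow_neg hvpos.le, ← Real.rpow_neg hvpos.le, ← Real.rpow_add hvpos]
    congr 1; push_cast; ring
  calc _ ≤ ‖v‖ ^ (n + 1) * ((kernelMass n)⁻¹ *
        (((n : ℝ) + 1) * ((‖v‖ ^ (n + 1))⁻¹ * (‖v‖ ^ 2)⁻¹))) := by
        rw [← h3]; gcongr
    _ = _ := by field_simp

/-- For `δ = c⁻²` the mollifier is the rescaling `c^(n+1) ψ(c (x - y))` of a fixed profile `ψ` of
mass `kernelMass n`. -/
theorem tendsto_integral_kernel {g : EuclideanSpace ℝ (Fin (n + 1)) → Cl n} (hg : Continuous g)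
    (hi : Integrable g) (x : EuclideanSpace ℝ (Fin (n + 1))) :
    Tendsto (fun c : ℝ => ∫ y, (((n : ℝ) + 1) * (c ^ 2)⁻¹ *
      (‖y - x‖ ^ 2 + (c ^ 2)⁻¹) ^ (-((n : ℝ) + 1) / 2 - 1)) • g y) atTop
      (𝓝 (kernelMass n • g x)) := by
  have hκ := kernelMass_pos n
  have := tendsto_integral_comp_smul_smul_of_integrable'
    (μ := (volume : Measure (EuclideanSpace ℝ (Fin (n + 1)))))
    (φ := fun v => (kernelMass n)⁻¹ *
        (((n : ℝ) + 1) * (1 + ‖v‖ ^ 2) ^ (-((n : ℝ) + 1) / 2 - 1)))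
    (fun v => by positivity)
    (by rw [integral_const_mul]; exact inv_mul_cancel₀ hκ.ne')
    (by rw [finrank_euclideanSpace_fin]; exact tendsto_norm_pow_mul_kernel n)
    hi (x₀ := x) hg.continuousAt
  refine (this.const_smul (kernelMass n)).congr' ?_
  filter_upwards [eventually_gt_atTop 0] with c hc
  rw [← integral_smul]
  refine integral_congr_ae (Eventually.of_forall fun y => ?_)
  simp only [smul_smul]
  congr 1
  rw [finrank_euclideanSpace_fin, norm_smul, norm_sub_rev x y, Real.norm_of_nonneg hc.le]
  set N := ‖y - x‖ ^ 2 + (c ^ 2)⁻¹ with hN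
  have hNpos : 0 < N := by positivity
  have h1 : 1 + (c * ‖y - x‖) ^ 2 = c ^ 2 * N := by rw [hN]; field_simp; ring
  rw [h1, Real.mul_rpow (by positivity) hNpos.le]
  have h2 : (c ^ 2) ^ (-((n : ℝ) + 1) / 2 - 1) = (c ^ (n + 1))⁻¹ * (c ^ 2)⁻¹ := by
    rw [← Real.rpow_natCast, ← Real.rpow_natCast, ← Real.rpow_mul hc.le,
      ← Real.rpow_neg hc.le, ← Real.rpow_neg hc.le, ← Real.rpow_add hc]
    congr 1; push_cast; ring
  rw [h2]
  field_simp

/-- The singularity at `y = x` is never met: where the gradient of `χ` is nonzero, `‖y - x‖ ≥ R -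
‖x‖ > 0`. -/
theorem integrable_cauchy_pompeiu {f : EuclideanSpace ℝ (Fin (n + 1)) → Cl n}
    (hf : Continuous f) {χ : EuclideanSpace ℝ (Fin (n + 1)) → ℝ} (hχ : ContDiff ℝ 1 χ)
    (hc : HasCompactSupport χ) {R : ℝ} (hR : ∀ y, ‖y‖ < R → cliffordGrad χ y = 0)
    {x : EuclideanSpace ℝ (Fin (n + 1))} (hx : ‖x‖ < R) :
    Integrable fun y => (‖y - x‖ ^ 2) ^ (-((n : ℝ) + 1) / 2) •
          (conjL n (y - x) * cliffordGrad χ y * f y) := by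
  have hcont : Continuous fun y => conjL n (y - x) * cliffordGrad χ y * f y :=
    Cl.continuous_mul (Cl.continuous_mul
      ((conjL n).continuous.comp (continuous_id.sub continuous_const))
      (continuous_cliffordGrad hχ)) hf
  have hcomp : HasCompactSupport fun y => conjL n (y - x) * cliffordGrad χ y * f y :=
    (hasCompactSupport_cliffordGrad hc).mono fun y hy h0 => hy (by
      simp only; rw [h0, mul_zero, zero_mul])
  refine ((hcont.integrable_of_hasCompactSupport hcomp).norm.const_mul
    (((R - ‖x‖) ^ 2) ^ (-((n : ℝ) + 1) / 2))).mono' ?_ (Eventually.of_forall fun y => ?_)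
  · refine AEStronglyMeasurable.smul (f := fun y => (‖y - x‖ ^ 2) ^ (-((n : ℝ) + 1) / 2)) ?_
      hcont.aestronglyMeasurable
    exact (((continuous_id.sub continuous_const).norm.pow 2).measurable.pow_const
      _).aestronglyMeasurable
  · rw [norm_smul]
    by_cases hy : ‖y‖ < R
    · rw [hR y hy]; simp
    · refine mul_le_mul_of_nonneg_right ?_ (norm_nonneg _)
      rw [Real.norm_of_nonneg (by positivity)]
      refine Real.rpow_le_rpow_of_nonpos (pow_pos (by linarith) 2) ?_ ?_
      · have h1 : R - ‖x‖ ≤ ‖y - x‖ := by linarith [norm_sub_norm_le y x]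
        exact pow_le_pow_left₀ (by linarith) h1 2
      · have : (0 : ℝ) ≤ n := Nat.cast_nonneg n
        linarith

/-- Let `δ = c⁻² → 0` in the regularized formula: one side is an approximate identity, the other
converges by domination, its integrand vanishing near `x`. -/
theorem cauchy_pompeiu {f : EuclideanSpace ℝ (Fin (n + 1)) → Cl n}
    (hf : IsLeftMonogenic f) {χ : EuclideanSpace ℝ (Fin (n + 1)) → ℝ} (hχ : ContDiff ℝ 1 χ)
    (hc : HasCompactSupport χ) {R : ℝ} (hR : ∀ y, ‖y‖ < R → cliffordGrad χ y = 0)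
    {x : EuclideanSpace ℝ (Fin (n + 1))} (hx : ‖x‖ < R) :
    kernelMass n • χ x • f x = -∫ y, (‖y - x‖ ^ 2) ^ (-((n : ℝ) + 1) / 2) •
          (conjL n (y - x) * cliffordGrad χ y * f y) := by
  have hcont : Continuous fun y => conjL n (y - x) * cliffordGrad χ y * f y :=
    Cl.continuous_mul (Cl.continuous_mul
      ((conjL n).continuous.comp (continuous_id.sub continuous_const))
      (continuous_cliffordGrad hχ)) hf.1.continuous
  have hcomp : HasCompactSupport fun y => conjL n (y - x) * cliffordGrad χ y * f y :=
    (hasCompactSupport_cliffordGrad hc).mono fun y hy h0 => hy (by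
      simp only; rw [h0, mul_zero, zero_mul])
  have hleft := tendsto_integral_kernel (g := fun y => χ y • f y)
    (hχ.continuous.smul hf.1.continuous)
    ((hχ.continuous.smul hf.1.continuous).integrable_of_hasCompactSupport
      (hc.mono fun y hy h0 => hy (by rw [Pi.smul_apply', h0, zero_smul]))) x
  refine tendsto_nhds_unique hleft ?_
  have hexp : -((n : ℝ) + 1) / 2 ≤ 0 := by
    have : (0 : ℝ) ≤ n := Nat.cast_nonneg n
    linarith
  have hlim : Tendsto (fun c : ℝ => ∫ y, (‖y - x‖ ^ 2 + (c ^ 2)⁻¹) ^ (-((n : ℝ) + 1) / 2) •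
      (conjL n (y - x) * cliffordGrad χ y * f y)) atTop
      (𝓝 (∫ y, (‖y - x‖ ^ 2) ^ (-((n : ℝ) + 1) / 2) •
        (conjL n (y - x) * cliffordGrad χ y * f y))) := by
    refine tendsto_integral_filter_of_dominated_convergence
      (fun y => ((R - ‖x‖) ^ 2) ^ (-((n : ℝ) + 1) / 2) *
        ‖conjL n (y - x) * cliffordGrad χ y * f y‖) ?_ ?_ ?_ ?_
    · filter_upwards [eventually_gt_atTop 0] with c hc0
      refine Continuous.aestronglyMeasurable (Continuous.smul (f := fun y =>
        (‖y - x‖ ^ 2 + (c ^ 2)⁻¹) ^ (-((n : ℝ) + 1) / 2)) ?_ hcont)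
      exact (((continuous_id.sub continuous_const).norm.pow 2).add
        continuous_const).rpow_const fun y => Or.inl (show ‖y - x‖ ^ 2 + (c ^ 2)⁻¹ ≠ 0 by positivity)
    · filter_upwards [eventually_gt_atTop 0] with c hc0
      refine Eventually.of_forall fun y => ?_
      rw [norm_smul]
      by_cases hy : ‖y‖ < R
      · rw [hR y hy]; simp
      · refine mul_le_mul_of_nonneg_right ?_ (norm_nonneg _)
        rw [Real.norm_of_nonneg (by positivity)]
        refine Real.rpow_le_rpow_of_nonpos (pow_pos (by linarith) 2) ?_ hexp
        have h1 : R - ‖x‖ ≤ ‖y - x‖ := by linarith [norm_sub_norm_le y x]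
        have h2 : (R - ‖x‖) ^ 2 ≤ ‖y - x‖ ^ 2 := pow_le_pow_left₀ (by linarith) h1 2
        have : 0 ≤ (c ^ 2)⁻¹ := by positivity
        linarith
    · exact (hcont.integrable_of_hasCompactSupport hcomp).norm.const_mul _
    · refine Eventually.of_forall fun y => ?_
      by_cases hy : ‖y‖ < R
      · rw [hR y hy]; simp
      · refine Tendsto.smul_const ?_ _
        have h1 : 0 < ‖y - x‖ := by linarith [norm_sub_norm_le y x]
        have h2 : Tendsto (fun c : ℝ => ‖y - x‖ ^ 2 + (c ^ 2)⁻¹) atTop (𝓝 (‖y - x‖ ^ 2)) := by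
          simpa using tendsto_const_nhds.add
            (tendsto_pow_atTop (α := ℝ) two_ne_zero).inv_tendsto_atTop
        exact h2.rpow_const (Or.inl (by positivity))
  refine hlim.neg.congr' ?_
  filter_upwards [eventually_gt_atTop 0] with c hc0
  exact (integral_regularized_cauchy hf hχ hc x (by positivity)).symm

/-! ### Homogeneity, and Cauchy's estimate along complexified lines -/

theorem prod_ofFn_smul (t : ℝ) {m : ℕ} (g : Fin m → Cl n) :
    (List.ofFn fun k => t • g k).prod = t ^ m • (List.ofFn g).prod := by
  induction m with
  | zero => simp
  | succ m ih =>
    rw [List.ofFn_succ, List.prod_cons, ih, List.ofFn_succ, List.prod_cons, smul_mul_smul_comm,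
      pow_succ']

theorem fueterPoly_smul (m : Fin n → ℕ) (t : ℝ) (x : EuclideanSpace ℝ (Fin (n + 1))) :
    fueterPoly m (t • x) = t ^ (∑ i, m i) • fueterPoly m x := by
  have hz : ∀ i, fueterVar i (t • x) = t • fueterVar i x := fun i => by
    simp [fueterVar, smul_sub, smul_smul]
  unfold fueterPoly
  rw [smul_comm]
  congr 1
  rw [Finset.smul_sum]
  refine Finset.sum_congr rfl fun w _ => ?_
  simp only [hz]
  exact prod_ofFn_smul t _

theorem homPart_smul (a : (Fin n → ℕ) → Cl n) (q : ℕ) (t : ℝ)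
    (x : EuclideanSpace ℝ (Fin (n + 1))) : homPart a q (t • x) = t ^ q • homPart a q x := by
  unfold homPart
  rw [Finset.smul_sum]
  refine Finset.sum_congr rfl fun m hm => ?_
  rw [fueterPoly_smul, Finset.Nat.mem_antidiagonalTuple.1 hm, smul_mul_assoc]

theorem homPart_smul_coeff (a : (Fin n → ℕ) → Cl n) (q : ℕ) (t : ℝ)
    (x : EuclideanSpace ℝ (Fin (n + 1))) :
    homPart (fun m => t ^ (∑ i, m i) • a m) q x = t ^ q • homPart a q x := by
  unfold homPart
  rw [Finset.smul_sum]
  refine Finset.sum_congr rfl fun m hm => ?_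
  beta_reduce
  rw [Finset.Nat.mem_antidiagonalTuple.1 hm, mul_smul_comm]

theorem IsLeftMonogenic.comp_smul {f : EuclideanSpace ℝ (Fin (n + 1)) → Cl n}
    (hf : IsLeftMonogenic f) (r : ℝ) : IsLeftMonogenic fun x => f (r • x) := by
  have hd : ∀ j x, partialDeriv j (fun x => f (r • x)) x = r • partialDeriv j f (r • x) := by
    intro j x
    unfold partialDeriv
    have h1 : HasFDerivAt (fun x : EuclideanSpace ℝ (Fin (n + 1)) => r • x)
        (r • ContinuousLinearMap.id ℝ _) x := (hasFDerivAt_id x).const_smul r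
    have h2 := ((hf.1.differentiable one_ne_zero (r • x)).hasFDerivAt).comp x h1
    have h3 := congrArg (fun T => T (EuclideanSpace.single j (1 : ℝ))) h2.fderiv
    refine Eq.trans h3 ?_
    simp
  refine ⟨hf.1.comp (contDiff_const_smul r), fun x => ?_⟩
  simp only [hd, mul_smul_comm, ← Finset.smul_sum, ← smul_add, hf.2, smul_zero]

/-- The holomorphic extension in `t` of a component of the Cauchy integral at the point `t x`. -/
def sliceIntegrand (χ : EuclideanSpace ℝ (Fin (n + 1)) → ℝ)
    (f : EuclideanSpace ℝ (Fin (n + 1)) → Cl n) (L : Cl n →L[ℝ] ℝ)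
    (x : EuclideanSpace ℝ (Fin (n + 1))) (t : ℂ) (y : EuclideanSpace ℝ (Fin (n + 1))) : ℂ :=
  (((‖y‖ ^ 2 : ℝ) : ℂ) - 2 * t * (inner ℝ y x : ℝ) + t ^ 2) ^ ((-((n : ℝ) + 1) / 2 : ℝ) : ℂ) *
    ((L (conjL n y * cliffordGrad χ y * f y) : ℝ)
      - t * (L (conjL n x * cliffordGrad χ y * f y) : ℝ))

theorem sliceIntegrand_eq_zero {χ : EuclideanSpace ℝ (Fin (n + 1)) → ℝ}
    {f : EuclideanSpace ℝ (Fin (n + 1)) → Cl n} {L : Cl n →L[ℝ] ℝ}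
    {x : EuclideanSpace ℝ (Fin (n + 1))} {t : ℂ} {y : EuclideanSpace ℝ (Fin (n + 1))}
    (h : cliffordGrad χ y = 0) : sliceIntegrand χ f L x t y = 0 := by
  simp [sliceIntegrand, h]

/-- For a unit vector `x` and real `t` the quadratic is `‖y - t x‖² ≥ 0`, where complex and real
powers agree. -/
theorem sliceIntegrand_ofReal {χ : EuclideanSpace ℝ (Fin (n + 1)) → ℝ}
    {f : EuclideanSpace ℝ (Fin (n + 1)) → Cl n} {L : Cl n →L[ℝ] ℝ}
    {x : EuclideanSpace ℝ (Fin (n + 1))} (hx : ‖x‖ = 1) (t : ℝ)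
    (y : EuclideanSpace ℝ (Fin (n + 1))) :
    sliceIntegrand χ f L x t y = ((L ((‖y - t • x‖ ^ 2) ^ (-((n : ℝ) + 1) / 2) •
          (conjL n (y - t • x) * cliffordGrad χ y * f y)) : ℝ) : ℂ) := by
  have h1 : ‖y - t • x‖ ^ 2 = ‖y‖ ^ 2 - 2 * t * inner ℝ y x + t ^ 2 := by
    rw [norm_sub_sq_real, inner_smul_right, norm_smul, hx, mul_one, Real.norm_eq_abs, sq_abs]
    ring
  have h2 : (((‖y‖ ^ 2 : ℝ) : ℂ) - 2 * t * (inner ℝ y x : ℝ) + (t : ℂ) ^ 2)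
      = ((‖y - t • x‖ ^ 2 : ℝ) : ℂ) := by
    rw [h1]; push_cast; ring
  unfold sliceIntegrand
  rw [h2, ← Complex.ofReal_cpow (by positivity), map_smul, smul_eq_mul, map_sub, map_smul,
    sub_mul, sub_mul, smul_mul_assoc, smul_mul_assoc, map_sub, map_smul, smul_eq_mul]
  push_cast
  ring

theorem measurable_sliceIntegrand {χ : EuclideanSpace ℝ (Fin (n + 1)) → ℝ} (hχ : ContDiff ℝ 1 χ)
    {f : EuclideanSpace ℝ (Fin (n + 1)) → Cl n} (hf : Continuous f) (L : Cl n →L[ℝ] ℝ)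
    (x : EuclideanSpace ℝ (Fin (n + 1))) (t : ℂ) : Measurable (sliceIntegrand χ f L x t) := by
  have hc1 : Continuous fun y => L (conjL n y * cliffordGrad χ y * f y) :=
    L.continuous.comp (Cl.continuous_mul (Cl.continuous_mul (conjL n).continuous
      (continuous_cliffordGrad hχ)) hf)
  have hc2 : Continuous fun y => L (conjL n x * cliffordGrad χ y * f y) :=
    L.continuous.comp (Cl.continuous_mul (Cl.continuous_mul continuous_const
      (continuous_cliffordGrad hχ)) hf)
  have hc3 : Continuous fun y : EuclideanSpace ℝ (Fin (n + 1)) =>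
      ((‖y‖ ^ 2 : ℝ) : ℂ) - 2 * t * (inner ℝ y x : ℝ) + t ^ 2 := by fun_prop
  exact (hc3.measurable.pow_const _).mul
    ((Complex.continuous_ofReal.comp hc1).sub
      (continuous_const.mul (Complex.continuous_ofReal.comp hc2))).measurable

theorem abs_inner_le_norm_of_unit {x y : EuclideanSpace ℝ (Fin (n + 1))} (hx : ‖x‖ = 1) :
    |inner ℝ y x| ≤ ‖y‖ := by
  simpa [hx] using abs_real_inner_le_norm y x

theorem differentiableOn_sliceIntegrand {χ : EuclideanSpace ℝ (Fin (n + 1)) → ℝ}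
    (f : EuclideanSpace ℝ (Fin (n + 1)) → Cl n) (L : Cl n →L[ℝ] ℝ) {R S : ℝ} (hSR : S < R)
    (hin : ∀ y, ‖y‖ < R → cliffordGrad χ y = 0)
    {x : EuclideanSpace ℝ (Fin (n + 1))} (hx : ‖x‖ = 1) (y : EuclideanSpace ℝ (Fin (n + 1))) :
    DifferentiableOn ℂ (fun t => sliceIntegrand χ f L x t y) (Metric.ball 0 S) := by
  by_cases hy1 : ‖y‖ < R
  · simp only [sliceIntegrand_eq_zero (hin y hy1)]; exact differentiableOn_const _
  intro t ht
  have ht : ‖t‖ < S := by simpa using ht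
  have hsl := Complex.quadratic_mem_slitPlane (abs_inner_le_norm_of_unit (y := y) hx) (t := t)
    (by linarith [not_lt.1 hy1])
  unfold sliceIntegrand
  refine (DifferentiableAt.mul ?_ (by fun_prop)).differentiableWithinAt
  exact DifferentiableAt.cpow (by fun_prop) (by fun_prop) hsl

theorem abs_map_conj_mul_grad_mul_le {L : Cl n →L[ℝ] ℝ} (hL : ‖L‖ ≤ 1) {D w : Cl n} {G M : ℝ}
    (hD : ‖D‖ ≤ G) (hw : ‖w‖ ≤ M) {z : EuclideanSpace ℝ (Fin (n + 1))} (hz : ‖z‖ ≤ 1) :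
    |L (conjL n z * D * w)| ≤ ‖Cl.mulL n‖ * (‖Cl.mulL n‖ * ‖conjL n‖ * G) * M := by
  have hLb : |L (conjL n z * D * w)| ≤ ‖conjL n z * D * w‖ := by
    have := L.le_opNorm (conjL n z * D * w)
    rw [Real.norm_eq_abs] at this
    nlinarith [norm_nonneg (conjL n z * D * w)]
  have hG0 : 0 ≤ G := (norm_nonneg _).trans hD
  refine hLb.trans ((Cl.norm_mul_le _ _).trans ?_)
  have h1 : ‖conjL n z‖ ≤ ‖conjL n‖ :=
    ((conjL n).le_opNorm z).trans (mul_le_of_le_one_right (norm_nonneg _) hz)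
  have h2 : ‖conjL n z * D‖ ≤ ‖Cl.mulL n‖ * ‖conjL n‖ * G := by
    refine (Cl.norm_mul_le _ _).trans ?_
    gcongr
  gcongr

/-- Only the annulus `R ≤ ‖y‖ ≤ 1` contributes; there the quadratic has modulus at least `(R - S)²`,
and its exponent is negative. The bound is linear in `M` and uniform in `x`, `t`, `y`. -/
theorem norm_sliceIntegrand_le {χ : EuclideanSpace ℝ (Fin (n + 1)) → ℝ}
    {f : EuclideanSpace ℝ (Fin (n + 1)) → Cl n} {L : Cl n →L[ℝ] ℝ} (hL : ‖L‖ ≤ 1) {R S : ℝ}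
    (hSR : S < R) (hS1 : S < 1)
    (hin : ∀ y, ‖y‖ < R → cliffordGrad χ y = 0)
    (hout : ∀ y, y ∉ Metric.closedBall (0 : EuclideanSpace ℝ (Fin (n + 1))) 1 →
      cliffordGrad χ y = 0)
    {G M : ℝ} (hG : ∀ y, ‖cliffordGrad χ y‖ ≤ G) (hM : ∀ x, ‖x‖ ≤ 1 → ‖f x‖ ≤ M)
    {x : EuclideanSpace ℝ (Fin (n + 1))} (hx : ‖x‖ = 1) {t : ℂ} (ht : ‖t‖ < S)
    (y : EuclideanSpace ℝ (Fin (n + 1))) :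
    ‖sliceIntegrand χ f L x t y‖ ≤ ((R - S) ^ 2) ^ (-((n : ℝ) + 1) / 2) *
      (2 * (‖Cl.mulL n‖ * (‖Cl.mulL n‖ * ‖conjL n‖ * G) * M)) := by
  have hG0 : 0 ≤ G := (norm_nonneg _).trans (hG 0)
  have hM0 : 0 ≤ M := (norm_nonneg _).trans (hM 0 (by simp))
  have hk0 : -((n : ℝ) + 1) / 2 ≤ 0 := by
    have : (0 : ℝ) ≤ n := Nat.cast_nonneg n
    linarith
  set B := ‖Cl.mulL n‖ * (‖Cl.mulL n‖ * ‖conjL n‖ * G) * M with hB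
  have hB0 : 0 ≤ B := mul_nonneg (mul_nonneg (norm_nonneg (Cl.mulL n))
    (mul_nonneg (mul_nonneg (norm_nonneg (Cl.mulL n)) (norm_nonneg (conjL n))) hG0)) hM0
  by_cases hy1 : ‖y‖ < R
  · rw [sliceIntegrand_eq_zero (hin y hy1), norm_zero]; positivity
  by_cases hy2 : y ∈ Metric.closedBall (0 : EuclideanSpace ℝ (Fin (n + 1))) 1
  swap
  · rw [sliceIntegrand_eq_zero (hout y hy2), norm_zero]; positivity
  have hy2 : ‖y‖ ≤ 1 := by simpa using hy2
  have hy1 : R ≤ ‖y‖ := not_lt.1 hy1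
  unfold sliceIntegrand
  rw [norm_mul, Complex.norm_cpow_real]
  refine mul_le_mul ?_ ?_ (norm_nonneg _) (by positivity)
  · refine Real.rpow_le_rpow_of_nonpos (pow_pos (by linarith) 2) ?_ hk0
    refine le_trans ?_ (Complex.sq_le_norm_quadratic (abs_inner_le_norm_of_unit hx)
      (by linarith))
    exact pow_le_pow_left₀ (by linarith) (by linarith) 2
  · refine (norm_sub_le _ _).trans ?_
    rw [norm_mul, Complex.norm_real, Complex.norm_real, Real.norm_eq_abs, Real.norm_eq_abs]
    have h3 := abs_map_conj_mul_grad_mul_le hL (hG y) (hM y hy2) hy2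
    have h4 := abs_map_conj_mul_grad_mul_le hL (hG y) (hM y hy2) hx.le
    rw [← hB] at h3 h4
    have h5 := mul_le_mul (ht.le.trans hS1.le) h4 (abs_nonneg _) zero_le_one
    linarith

/-- The numbers `L (P_q x)` are the Taylor coefficients of `t ↦ L (f (t x))`, which the
Cauchy–Pompeiu integral extends holomorphically to `|t| < S`. -/
theorem abs_map_homPart_mul_pow_le {f : EuclideanSpace ℝ (Fin (n + 1)) → Cl n}
    {a : (Fin n → ℕ) → Cl n} (hf : IsLeftMonogenic f)
    (hfa : ∀ x, HasSum (fun q => homPart a q x) (f x))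
    {χ : EuclideanSpace ℝ (Fin (n + 1)) → ℝ} (hχ : ContDiff ℝ 1 χ) (hχc : HasCompactSupport χ)
    (L : Cl n →L[ℝ] ℝ) {R S s B : ℝ} (hSR : S < R) (hs : 0 < s) (hsS : s < S)
    (hχ1 : ∀ y, ‖y‖ < R → χ y = 1)
    (hin : ∀ y, ‖y‖ < R → cliffordGrad χ y = 0)
    (hout : ∀ y, y ∉ Metric.closedBall (0 : EuclideanSpace ℝ (Fin (n + 1))) 1 →
      cliffordGrad χ y = 0)
    {x : EuclideanSpace ℝ (Fin (n + 1))} (hx : ‖x‖ = 1)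
    (hB : ∀ t ∈ Metric.ball (0 : ℂ) S, ∀ y, ‖sliceIntegrand χ f L x t y‖ ≤ B) (q : ℕ) :
    |L (homPart a q x)| * s ^ q ≤ (kernelMass n)⁻¹ *
      (B * volume.real (Metric.closedBall (0 : EuclideanSpace ℝ (Fin (n + 1))) 1)) := by
  have hκ := kernelMass_pos n
  -- Restriction to the unit ball makes the measure finite and loses nothing, since the gradient of
  -- `χ` vanishes outside.
  set μ := (volume : Measure (EuclideanSpace ℝ (Fin (n + 1)))).restrict
    (Metric.closedBall 0 1) with hμ
  have : IsFiniteMeasure μ := ⟨by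
    rw [hμ, Measure.restrict_apply_univ]; exact measure_closedBall_lt_top⟩
  have hhol := Complex.differentiableOn_integral_of_bounded (μ := μ)
    (fun t _ => (measurable_sliceIntegrand hχ hf.1.continuous L x t).aestronglyMeasurable) hB
    (differentiableOn_sliceIntegrand f L hSR hin hx)
  have hLsum : ∀ t : ℝ, HasSum (fun q => t ^ q * L (homPart a q x)) (L (f (t • x))) := by
    intro t
    have := (hfa (t • x)).mapL L
    simpa [homPart_smul] using this
  refine Complex.abs_coeff_mul_pow_le (R := S)
    hLsum (h := fun t => (-(kernelMass n)⁻¹ : ℝ) * ∫ y, sliceIntegrand χ f L x t y ∂μ)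
    (hhol.const_mul _) ?_ ?_ hs hsS q
  · intro t ht
    rw [norm_mul, Complex.norm_real, norm_neg, Real.norm_of_nonneg (by positivity)]
    refine mul_le_mul_of_nonneg_left ?_ (by positivity)
    have := norm_integral_le_of_norm_le_const (μ := μ) (Eventually.of_forall (hB t ht))
    refine this.trans (le_of_eq ?_)
    rw [hμ, Measure.real, Measure.restrict_apply_univ, Measure.real]
  · intro t ht
    have htx : ‖t • x‖ < R := by rw [norm_smul, hx, mul_one, Real.norm_eq_abs]; linarith
    have hcp := congrArg L (cauchy_pompeiu hf hχ hχc hin htx)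
    rw [hχ1 _ htx, one_smul, map_smul, map_neg, ← L.integral_comp_comm
      (integrable_cauchy_pompeiu hf.1.continuous hχ hχc hin htx), smul_eq_mul] at hcp
    simp only [sliceIntegrand_ofReal hx]
    rw [integral_complex_ofReal, hμ, setIntegral_eq_integral_of_forall_compl_eq_zero]
    · rw [← Complex.ofReal_mul, neg_mul, ← mul_neg, ← hcp, inv_mul_cancel_left₀ hκ.ne']
    · intro y hy
      rw [hout y hy, mul_zero, zero_mul, smul_zero, map_zero]

theorem exists_norm_homPart_mul_pow_le_of_unit (n : ℕ) {s : ℝ} (hs : 0 < s) (hs1 : s < 1) :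
    ∃ C > 0, ∀ (f : EuclideanSpace ℝ (Fin (n + 1)) → Cl n) (a : (Fin n → ℕ) → Cl n) (M : ℝ),
      IsLeftMonogenic f → (∀ x, HasSum (fun q => homPart a q x) (f x)) →
      (∀ x, ‖x‖ ≤ 1 → ‖f x‖ ≤ M) → ∀ q x, ‖x‖ = 1 → ‖homPart a q x‖ * s ^ q ≤ C * M := by
  -- `s < S < R < 1`: Cauchy's estimate at radius `s`, holomorphy for `|t| < S`, cutoff equal to `1`
  -- on the ball of radius `R`.
  obtain ⟨S, hsS, hS1⟩ := exists_between hs1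
  obtain ⟨R, hSR, hR1⟩ := exists_between hS1
  have hR0 : 0 < R := (hs.trans hsS).trans hSR
  let χ : ContDiffBump (0 : EuclideanSpace ℝ (Fin (n + 1))) := ⟨R, 1, hR0, hR1⟩
  have hχ1 : ∀ y, ‖y‖ < R → χ y = 1 := fun y hy =>
    χ.one_of_mem_closedBall (by simpa using hy.le)
  have hin : ∀ y, ‖y‖ < R → cliffordGrad χ y = 0 := by
    intro y hy
    refine cliffordGrad_eq_zero_of_fderiv ?_
    have : (χ : EuclideanSpace ℝ (Fin (n + 1)) → ℝ) =ᶠ[𝓝 y] fun _ => 1 := by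
      filter_upwards [Metric.isOpen_ball.mem_nhds
        (show y ∈ Metric.ball (0 : EuclideanSpace ℝ (Fin (n + 1))) R by simpa using hy)] with z hz
      exact hχ1 z (by simpa using hz)
    rw [this.fderiv_eq]; simp
  have hout : ∀ y, y ∉ Metric.closedBall (0 : EuclideanSpace ℝ (Fin (n + 1))) 1 →
      cliffordGrad χ y = 0 := by
    intro y hy
    refine cliffordGrad_eq_zero_of_fderiv ?_
    have h1 : y ∉ tsupport χ := by rw [χ.tsupport_eq]; exact hy
    exact image_eq_zero_of_notMem_tsupport fun h => h1 (tsupport_fderiv_subset ℝ h)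
  obtain ⟨G, hG⟩ := (hasCompactSupport_cliffordGrad
    χ.hasCompactSupport).exists_bound_of_continuous
    (continuous_cliffordGrad χ.contDiff)
  have hG0 : 0 ≤ G := (norm_nonneg _).trans (hG 0)
  have hκ := kernelMass_pos n
  have hm0 : 0 ≤ ‖Cl.mulL n‖ := norm_nonneg (Cl.mulL n)
  have hj0 : 0 ≤ ‖conjL n‖ := norm_nonneg (conjL n)
  -- The final `+ 1` only serves to make the constant positive.
  refine ⟨(kernelMass n)⁻¹ * (((R - S) ^ 2) ^ (-((n : ℝ) + 1) / 2) *
      (2 * (‖Cl.mulL n‖ * (‖Cl.mulL n‖ * ‖conjL n‖ * G))) *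
      volume.real (Metric.closedBall (0 : EuclideanSpace ℝ (Fin (n + 1))) 1)) + 1,
    by positivity, ?_⟩
  intro f a M hf hfa hM q x hx
  have hM0 : 0 ≤ M := (norm_nonneg _).trans (hM 0 (by simp))
  obtain ⟨L, hL1, hLx⟩ := exists_dual_vector'' ℝ (homPart a q x)
  have hest := abs_map_homPart_mul_pow_le hf hfa χ.contDiff χ.hasCompactSupport L hSR hs hsS hχ1
    hin hout hx (fun t ht => norm_sliceIntegrand_le hL1 hSR hS1 hin hout hG hM hx
      (by simpa using ht)) q
  rw [hLx] at hest
  simp only [RCLike.ofReal_real_eq_id, id_eq, abs_norm] at hest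
  refine hest.trans ?_
  rw [add_mul, one_mul]
  refine le_add_of_le_of_nonneg (le_of_eq ?_) hM0
  ring

/-- Cauchy's estimate for the homogeneous parts of an entire monogenic function, with a constant
that does not depend on the degree when the radius is shrunk by an arbitrary factor `s < 1`. -/
theorem exists_norm_homPart_mul_pow_le (n : ℕ) {s : ℝ} (hs : 0 < s) (hs1 : s < 1) :
    ∃ C > 0, ∀ (f : EuclideanSpace ℝ (Fin (n + 1)) → Cl n) (a : (Fin n → ℕ) → Cl n),
      IsLeftMonogenic f → (∀ x, HasSum (fun q => homPart a q x) (f x)) →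
      ∀ r M : ℝ, 0 < r → (∀ x, ‖x‖ ≤ r → ‖f x‖ ≤ M) →
      ∀ q x, ‖x‖ ≤ 1 → ‖homPart a q x‖ * (s * r) ^ q ≤ C * M := by
  obtain ⟨C, hC, h⟩ := exists_norm_homPart_mul_pow_le_of_unit n hs hs1
  refine ⟨C, hC, fun f a hf hfa r M hr hM q x hx => ?_⟩
  -- Dilation by `r` reduces to the unit ball; homogeneity then passes from the sphere to the ball.
  have key : ∀ u : EuclideanSpace ℝ (Fin (n + 1)), ‖u‖ = 1 →
      ‖homPart a q u‖ * (s * r) ^ q ≤ C * M := by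
    intro u hu
    have := h (fun x => f (r • x)) (fun m => r ^ (∑ i, m i) • a m) M (hf.comp_smul r)
      (fun x => by
        have := hfa (r • x)
        simp only [homPart_smul] at this
        simpa only [homPart_smul_coeff] using this)
      (fun x hx => hM _ (by
        rw [norm_smul, Real.norm_of_nonneg hr.le]; nlinarith)) q u hu
    rw [homPart_smul_coeff, norm_smul, norm_pow, Real.norm_of_nonneg hr.le] at this
    rw [mul_pow]; linarith
  obtain ⟨u, hu, hxu⟩ : ∃ u : EuclideanSpace ℝ (Fin (n + 1)), ‖u‖ = 1 ∧ x = ‖x‖ • u := by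
    by_cases hx0 : x = 0
    · exact ⟨EuclideanSpace.single 0 1, by simp, by simp [hx0]⟩
    · refine ⟨‖x‖⁻¹ • x, by simp [norm_smul, hx0], ?_⟩
      rw [smul_smul, mul_inv_cancel₀ (norm_ne_zero_iff.2 hx0), one_smul]
  have h1 := key u hu
  rw [hxu, homPart_smul, norm_smul]
  have h2 : ‖‖x‖ ^ q‖ ≤ 1 := by
    rw [norm_pow, norm_norm]; exact pow_le_one₀ (norm_nonneg _) hx
  have h3 : 0 ≤ ‖homPart a q u‖ * (s * r) ^ q := by positivity
  nlinarith

/-! ### Proximate orders and the inverse function -/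

variable {ρ : ℝ} {p p' : ℝ → ℝ}

/-- The logarithm `p(r) ln r` of `r ^ p(r)` varies like `ρ ln r`. -/
theorem IsProximateOrder.exists_abs_sub_le (hp : IsProximateOrder ρ p) {δ : ℝ} (hδ : 0 < δ) :
    ∃ s₀, 1 ≤ s₀ ∧ ∀ r s, s₀ ≤ r → s₀ ≤ s →
      |p r * Real.log r - p s * Real.log s - ρ * (Real.log r - Real.log s)|
        ≤ δ * |Real.log r - Real.log s| := by
  have hlim : Tendsto (fun r => p r + deriv p r * r * Real.log r) atTop (𝓝 ρ) := by
    simpa using hp.tendsto.add hp.tendsto_deriv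
  obtain ⟨s₁, hs₁⟩ := eventually_atTop.1 (hlim.eventually (Metric.closedBall_mem_nhds ρ hδ))
  refine ⟨max s₁ 1, le_max_right _ _, fun r s hr hs => ?_⟩
  have hr0 : 0 < r := by linarith [le_max_right s₁ 1]
  have hs0 : 0 < s := by linarith [le_max_right s₁ 1]
  set u₀ := Real.log (max s₁ 1) with hu₀
  have hmax : 0 < max s₁ 1 := by linarith [le_max_right s₁ 1]
  -- In the variable `u = ln r`, `p(r) ln r` has derivative `p + p' r ln r → ρ`; the mean value
  -- inequality finishes.
  have hd : ∀ u ∈ Set.Ici u₀, HasDerivWithinAt (fun u => p (Real.exp u) * u - ρ * u)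
      (p (Real.exp u) + deriv p (Real.exp u) * Real.exp u * u - ρ) (Set.Ici u₀) u := by
    intro u _
    have h1 : HasDerivAt p (deriv p (Real.exp u)) (Real.exp u) :=
      ((hp.differentiableOn _ (Real.exp_pos u).le).differentiableAt
        (Ici_mem_nhds (Real.exp_pos u))).hasDerivAt
    have h2 := ((h1.comp u (Real.hasDerivAt_exp u)).mul (hasDerivAt_id u)).sub
      ((hasDerivAt_id u).const_mul ρ)
    refine (h2.congr_deriv ?_).hasDerivWithinAt
    simp only [Function.comp, id]
    ring
  have hb : ∀ u ∈ Set.Ici u₀,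
      ‖p (Real.exp u) + deriv p (Real.exp u) * Real.exp u * u - ρ‖ ≤ δ := by
    intro u hu
    have h1 : max s₁ 1 ≤ Real.exp u := (Real.log_le_iff_le_exp hmax).1 hu
    have := hs₁ (Real.exp u) ((le_max_left _ _).trans h1)
    rwa [Real.log_exp, dist_eq_norm] at this
  have := (convex_Ici u₀).norm_image_sub_le_of_norm_hasDerivWithin_le hd hb
    (Real.log_le_log hmax hs) (Real.log_le_log hmax hr)
  simp only [Real.exp_log hr0, Real.exp_log hs0, Real.norm_eq_abs] at this
  refine le_trans (le_of_eq ?_) this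
  congr 1; ring

theorem rpow_eq_exp_mul_log {r : ℝ} (hr : 0 < r) (c : ℝ) : r ^ c = Real.exp (c * Real.log r) := by
  rw [Real.rpow_def_of_pos hr, mul_comm]

theorem IsProximateOrder.eventually_rpow_half_le (hp : IsProximateOrder ρ p) (hρ : 0 < ρ) :
    ∀ᶠ r in atTop, r ^ (ρ / 2) ≤ r ^ p r := by
  filter_upwards [eventually_ge_atTop 1, hp.tendsto.eventually (lt_mem_nhds (half_lt_self hρ))]
    with r hr h using Real.rpow_le_rpow_of_exponent_le hr h.le

theorem IsProximateOrder.eventually_mul_log_le (hp : IsProximateOrder ρ p) (hρ : 0 < ρ)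
    (K : ℝ) {ε : ℝ} (hε : 0 < ε) : ∀ᶠ r in atTop, K * Real.log r ≤ ε * r ^ p r := by
  have hlim : Tendsto (fun r => K * (Real.log r / r ^ (ρ / 2))) atTop (𝓝 0) := by
    simpa using (isLittleO_log_rpow_atTop (half_pos hρ)).tendsto_div_nhds_zero.const_mul K
  filter_upwards [hlim.eventually (gt_mem_nhds hε), hp.eventually_rpow_half_le hρ,
    eventually_gt_atTop 0] with r h1 h2 hr
  have hpos : 0 < r ^ (ρ / 2) := by positivity
  rw [mul_div_assoc', div_lt_iff₀ hpos] at h1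
  nlinarith

theorem IsProximateOrder.tendsto_rpow (hp : IsProximateOrder ρ p) (hρ : 0 < ρ) :
    Tendsto (fun r => r ^ p r) atTop atTop :=
  tendsto_atTop_mono' _ (hp.eventually_rpow_half_le hρ) (tendsto_rpow_atTop (half_pos hρ))

namespace IsNormalization

theorem inverseFn_pos (h : IsNormalization ρ p p') {t : ℝ} (ht : 0 < t) : 0 < inverseFn p' t :=
  h.bijOn.surjOn.mapsTo_invFunOn ht

theorem inverseFn_rpow (h : IsNormalization ρ p p') {t : ℝ} (ht : 0 < t) :
    inverseFn p' t ^ p' (inverseFn p' t) = t :=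
  h.bijOn.surjOn.rightInvOn_invFunOn ht

theorem mul_log_inverseFn (h : IsNormalization ρ p p') {t : ℝ} (ht : 0 < t) :
    p' (inverseFn p' t) * Real.log (inverseFn p' t) = Real.log t := by
  rw [← Real.log_rpow (h.inverseFn_pos ht), h.inverseFn_rpow ht]

theorem tendsto_inverseFn (h : IsNormalization ρ p p') : Tendsto (inverseFn p') atTop atTop := by
  refine tendsto_atTop.2 fun b => ?_
  have hm : (0 : ℝ) < max b 1 := lt_max_of_lt_right one_pos
  filter_upwards [eventually_gt_atTop 0, eventually_ge_atTop (max b 1 ^ p' (max b 1))]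
    with t ht h1
  by_contra hcon
  push Not at hcon
  have h2 : inverseFn p' t < max b 1 := hcon.trans_le (le_max_left _ _)
  have h3 := h.strictMonoOn (h.inverseFn_pos ht) hm h2
  simp only [h.inverseFn_rpow ht] at h3
  linarith

/-- The inverse function varies regularly with exponent `1/ρ`: if `D` is the difference, then `|ln c
+ ρ D| ≤ δ |D|` for large `t`. -/
theorem tendsto_log_inverseFn_sub (h : IsNormalization ρ p p') (hρ : 0 < ρ) {c : ℝ} (hc : 0 < c) :
    Tendsto (fun t => Real.log (inverseFn p' t) - Real.log (inverseFn p' (c * t))) atTop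
      (𝓝 (-(Real.log c / ρ))) := by
  rw [Metric.tendsto_nhds]
  intro ε hε
  -- `δ ≤ ρ / 2` gives `|D| ≤ 2 |ln c| / ρ`, so the error `δ |D| / ρ` is at most `2 δ |ln c| / ρ²`.
  obtain ⟨δ, hδ0, hδρ, hδε⟩ : ∃ δ > 0, δ ≤ ρ / 2 ∧ 2 * δ * |Real.log c| / ρ ^ 2 < ε := by
    refine ⟨min (ρ / 2) (ε * ρ ^ 2 / (4 * (|Real.log c| + 1))), by positivity,
      min_le_left _ _, ?_⟩
    have h1 := min_le_right (ρ / 2) (ε * ρ ^ 2 / (4 * (|Real.log c| + 1)))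
    rw [le_div_iff₀ (by positivity)] at h1
    rw [div_lt_iff₀ (by positivity)]
    have h2 : 0 < ε * ρ ^ 2 := by positivity
    have h3 : 0 < min (ρ / 2) (ε * ρ ^ 2 / (4 * (|Real.log c| + 1))) := by positivity
    nlinarith [abs_nonneg (Real.log c)]
  obtain ⟨s₀, _, hs₀⟩ := h.isProximateOrder.exists_abs_sub_le hδ0
  have hct : Tendsto (fun t : ℝ => c * t) atTop atTop := tendsto_id.const_mul_atTop hc
  filter_upwards [eventually_gt_atTop 0, h.tendsto_inverseFn.eventually_ge_atTop s₀,
    (h.tendsto_inverseFn.comp hct).eventually_ge_atTop s₀] with t ht h1 h2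
  have key := hs₀ _ _ h1 h2
  simp only [Function.comp] at key
  rw [h.mul_log_inverseFn ht, h.mul_log_inverseFn (mul_pos hc ht),
    Real.log_mul hc.ne' ht.ne'] at key
  set D := Real.log (inverseFn p' t) - Real.log (inverseFn p' (c * t)) with hD
  rw [show Real.log t - (Real.log c + Real.log t) - ρ * D = -(Real.log c + ρ * D) by ring,
    abs_neg] at key
  rw [Real.dist_eq, show D - -(Real.log c / ρ) = (Real.log c + ρ * D) / ρ by field_simp; ring,
    abs_div, abs_of_pos hρ]
  have h3 : ρ * |D| ≤ |Real.log c| + δ * |D| := by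
    have := abs_sub_abs_le_abs_sub (ρ * D) (-Real.log c)
    rw [abs_mul, abs_of_pos hρ, abs_neg, sub_neg_eq_add, add_comm (ρ * D)] at this
    linarith
  have h4 : ρ * |D| ≤ 2 * |Real.log c| := by nlinarith [abs_nonneg D]
  refine lt_of_le_of_lt ?_ hδε
  rw [div_le_div_iff₀ hρ (by positivity)]
  calc |Real.log c + ρ * D| * ρ ^ 2 ≤ δ * |D| * ρ ^ 2 := by gcongr
    _ = δ * (ρ * |D|) * ρ := by ring
    _ ≤ δ * (2 * |Real.log c|) * ρ := by gcongr
    _ = _ := by ring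

/-- With `D = ln φ(t) - ln r` one has `t ≈ r^p'(r) e^(ρ D)`, so the left side is about `r^p'(r) e^(ρ
D) (ℓ - D)`. The maximum of `e^(ρ D) (ℓ - D)` is `exp (ρ ℓ - 1) / ρ`, at `ℓ - D = 1/ρ`. The
threshold is uniform in `t` and `r`. -/
theorem eventually_mul_le (h : IsNormalization ρ p p') (hρ : 0 < ρ) {ℓ A : ℝ}
    (hA : Real.exp (ρ * ℓ - 1) / ρ < A) :
    ∃ s₀, ∀ t r : ℝ, s₀ ≤ t → s₀ ≤ r →
      t * (ℓ + Real.log r - Real.log (inverseFn p' t)) ≤ A * r ^ p' r := by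
  have hcont : ContinuousAt (fun c : ℝ => Real.exp (c * ℓ - 1) / c) ρ := by
    refine ContinuousAt.div (by fun_prop) continuousAt_id hρ.ne'
  obtain ⟨η, hη0, hη⟩ := Metric.eventually_nhds_iff.1 (hcont.eventually (gt_mem_nhds hA))
  obtain ⟨δ, hδ0, hδη, hδρ⟩ : ∃ δ > 0, δ < η ∧ δ < ρ :=
    ⟨min η ρ / 2, by positivity, by
      have := min_le_left η ρ; have : 0 < min η ρ := by positivity
      linarith, by
      have := min_le_right η ρ; have : 0 < min η ρ := by positivity
      linarith⟩
  have hmax : ∀ c, 0 < c → ∀ y : ℝ, Real.exp (c * (ℓ - y)) * y ≤ Real.exp (c * ℓ - 1) / c := by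
    intro c hc y
    rw [le_div_iff₀ hc]
    have h1 : c * y ≤ Real.exp (c * y - 1) := by linarith [Real.add_one_le_exp (c * y - 1)]
    calc Real.exp (c * (ℓ - y)) * y * c = Real.exp (c * (ℓ - y)) * (c * y) := by ring
      _ ≤ Real.exp (c * (ℓ - y)) * Real.exp (c * y - 1) := by gcongr
      _ = _ := by rw [← Real.exp_add]; congr 1; ring
  obtain ⟨s₁, hs₁1, hs₁⟩ := h.isProximateOrder.exists_abs_sub_le hδ0
  obtain ⟨t₁, ht₁⟩ := eventually_atTop.1 (h.tendsto_inverseFn.eventually_ge_atTop s₁)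
  refine ⟨max s₁ t₁, fun t r ht hr => ?_⟩
  have ht0 : 0 < t := by linarith [le_max_left s₁ t₁]
  have hr0 : 0 < r := by linarith [le_max_left s₁ t₁]
  have key := hs₁ _ _ (ht₁ t ((le_max_right _ _).trans ht)) ((le_max_left _ _).trans hr)
  rw [h.mul_log_inverseFn ht0] at key
  set D := Real.log (inverseFn p' t) - Real.log r with hD
  rw [show ℓ + Real.log r - Real.log (inverseFn p' t) = ℓ - D by rw [hD]; ring]
  have hA0 : 0 < A := lt_of_le_of_lt (by positivity) hA
  by_cases hy : ℓ - D ≤ 0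
  · have : 0 ≤ A * r ^ p' r := by positivity
    nlinarith
  push Not at hy
  have h1 : Real.log t ≤ p' r * Real.log r + (ρ * D + δ * |D|) := by
    linarith [le_abs_self (Real.log t - p' r * Real.log r - ρ * D)]
  -- The error `δ |D|` merely perturbs the exponent `ρ` to `ρ ± δ`, according to the sign of `D`.
  obtain ⟨c, hc0, hcη, hcD⟩ : ∃ c, 0 < c ∧ dist c ρ < η ∧ ρ * D + δ * |D| = c * D := by
    rcases le_total 0 D with h0 | h0
    · exact ⟨ρ + δ, by positivity, by simpa [abs_of_pos hδ0] using hδη, by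
        rw [abs_of_nonneg h0]; ring⟩
    · exact ⟨ρ - δ, by linarith, by simpa [Real.dist_eq, abs_of_pos hδ0] using hδη, by
        rw [abs_of_nonpos h0]; ring⟩
  rw [hcD] at h1
  have h2 : t ≤ r ^ p' r * Real.exp (c * D) := by
    rw [rpow_eq_exp_mul_log hr0, ← Real.exp_add]
    exact (Real.log_le_iff_le_exp ht0).1 h1
  have h3 := (hmax c hc0 (ℓ - D)).trans (hη hcη).le
  rw [sub_sub_cancel] at h3
  calc t * (ℓ - D) ≤ r ^ p' r * Real.exp (c * D) * (ℓ - D) := by gcongr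
    _ = (Real.exp (c * D) * (ℓ - D)) * r ^ p' r := by ring
    _ ≤ A * r ^ p' r := by gcongr

end IsNormalization

/-! ### The two growth estimates -/

/-- Cauchy's estimate at `r = φ(q / (A ρ))`, where `A r^p(r) = q / ρ`: asymptotically the minimum of
`exp (A r^p(r)) / r^q`. -/
theorem eventually_norm_homPart_le (h : IsNormalization ρ p p') (hρ : 0 < ρ)
    {f : EuclideanSpace ℝ (Fin (n + 1)) → Cl n} (hf : IsLeftMonogenic f)
    {a : (Fin n → ℕ) → Cl n} (hfa : ∀ x, HasSum (fun q : ℕ => homPart a q x) (f x))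
    {A : ℝ} (hA : 0 < A) (hM : ∀ᶠ r : ℝ in atTop, ∀ x, ‖x‖ ≤ r → ‖f x‖ ≤ Real.exp (A * r ^ p r))
    {b : ℝ} (hb : (1 + Real.log (A * ρ)) / ρ < b) :
    ∀ᶠ q : ℕ in atTop, ∀ x, ‖x‖ ≤ 1 →
      ‖homPart a q x‖ ≤ Real.exp (q * (b - Real.log (inverseFn p' q))) := by
  set b₀ := (1 + Real.log (A * ρ)) / ρ with hb₀
  -- Shrinking the radius by `s` spends half of the gap `b - b₀`; the rest absorbs `ln C / q` and
  -- the error in `φ`.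
  set s := Real.exp (-((b - b₀) / 2)) with hs
  obtain ⟨C, hC, hest⟩ := exists_norm_homPart_mul_pow_le n (s := s) (Real.exp_pos _)
    (by rw [hs, Real.exp_lt_one_iff]; linarith)
  set c := (A * ρ)⁻¹ with hc
  have hc0 : 0 < c := by positivity
  have hct : Tendsto (fun q : ℕ => c * (q : ℝ)) atTop atTop :=
    tendsto_natCast_atTop_atTop.const_mul_atTop hc0
  have hφ := h.tendsto_inverseFn.comp hct
  -- This is `1/q` times the logarithm of the Cauchy bound, plus `ln φ(q)`.
  have hlim : Tendsto (fun q : ℕ => Real.log C / q + (1 / ρ + (b - b₀) / 2) +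
      (Real.log (inverseFn p' q) - Real.log (inverseFn p' (c * q)))) atTop
      (𝓝 (0 + (1 / ρ + (b - b₀) / 2) + -(Real.log c / ρ))) :=
    ((tendsto_const_div_atTop_nhds_zero_nat _).add tendsto_const_nhds).add
      ((h.tendsto_log_inverseFn_sub hρ hc0).comp tendsto_natCast_atTop_atTop)
  have hlt : 0 + (1 / ρ + (b - b₀) / 2) + -(Real.log c / ρ) < b := by
    have : 1 / ρ - Real.log c / ρ = b₀ := by
      rw [hb₀, hc, Real.log_inv]; ring
    linarith
  obtain ⟨r₁, _, hr₁⟩ := h.eventually_eq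
  filter_upwards [hlim.eventually (gt_mem_nhds hlt), hφ.eventually hM,
    hφ.eventually_ge_atTop r₁, eventually_gt_atTop 0] with q h1 h2 h3 hq x hx
  simp only [Function.comp] at h2 h3
  have hq0 : (0 : ℝ) < q := Nat.cast_pos.2 hq
  have hr0 := h.inverseFn_pos (mul_pos hc0 hq0)
  have hV : A * inverseFn p' (c * q) ^ p (inverseFn p' (c * q)) = q / ρ := by
    rw [← hr₁ _ h3, h.inverseFn_rpow (mul_pos hc0 hq0), hc]
    field_simp
  rw [hV] at h2
  have h4 := hest f a hf hfa _ _ hr0 h2 q x hx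
  have h5 : (s * inverseFn p' (c * q)) ^ q
      = Real.exp (q * (-((b - b₀) / 2) + Real.log (inverseFn p' (c * q)))) := by
    rw [← Real.rpow_natCast, rpow_eq_exp_mul_log (by positivity),
      Real.log_mul (Real.exp_pos _).ne' hr0.ne', Real.log_exp]
  rw [h5, ← le_div_iff₀ (Real.exp_pos _)] at h4
  refine h4.trans ?_
  rw [← Real.exp_log hC, ← Real.exp_add, ← Real.exp_sub, Real.exp_le_exp]
  have h6 := mul_le_mul_of_nonneg_left h1.le hq0.le
  rw [mul_add, mul_add, mul_div_cancel₀ _ hq0.ne'] at h6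
  have h7 : (q : ℝ) / ρ = q * (1 / ρ) := by ring
  rw [h7]
  linarith

/-- Two strict inequalities give room: `ℓ < ℓ₁` yields a geometric factor `θ^q` in the large-degree
terms, and `A₁ < A` absorbs the sum `W` of the weights. The finitely many small degrees grow
polynomially. -/
theorem eventually_norm_le (h : IsNormalization ρ p p') (hρ : 0 < ρ)
    {f : EuclideanSpace ℝ (Fin (n + 1)) → Cl n}
    {a : (Fin n → ℕ) → Cl n} (hfa : ∀ x, HasSum (fun q : ℕ => homPart a q x) (f x))
    (hB : ∀ q : ℕ, ∃ B : ℝ, ∀ x, ‖x‖ ≤ 1 → ‖homPart a q x‖ ≤ B)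
    {ℓ : ℝ} (hℓ : ∀ᶠ q : ℕ in atTop, ∀ x, ‖x‖ ≤ 1 →
      ‖homPart a q x‖ ≤ Real.exp (q * (ℓ - Real.log (inverseFn p' q))))
    {A : ℝ} (hA : Real.exp (ρ * ℓ - 1) / ρ < A) :
    ∀ᶠ r : ℝ in atTop, ∀ x, ‖x‖ ≤ r → ‖f x‖ ≤ Real.exp (A * r ^ p r) := by
  obtain ⟨A₁, hA₁, hA₁A⟩ := exists_between hA
  obtain ⟨ℓ₁, hℓ₁, hℓℓ₁⟩ : ∃ ℓ₁, Real.exp (ρ * ℓ₁ - 1) / ρ < A₁ ∧ ℓ < ℓ₁ := by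
    have hcont : ContinuousAt (fun l : ℝ => Real.exp (ρ * l - 1) / ρ) ℓ := by fun_prop
    have h1 : ∀ᶠ l in 𝓝[>] ℓ, Real.exp (ρ * l - 1) / ρ < A₁ :=
      (hcont.eventually (gt_mem_nhds hA₁)).filter_mono nhdsWithin_le_nhds
    exact (h1.and self_mem_nhdsWithin).exists
  have hA₁0 : 0 < A₁ := lt_of_le_of_lt (by positivity) hA₁
  obtain ⟨s₀, hs₀⟩ := h.eventually_mul_le hρ hℓ₁
  obtain ⟨q₁, hq₁⟩ := eventually_atTop.1
    (hℓ.and (tendsto_natCast_atTop_atTop.eventually_ge_atTop s₀))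
  choose B hB using hB
  have hB0 : ∀ q, 0 ≤ B q := fun q => (norm_nonneg _).trans (hB q 0 (by simp))
  set θ := Real.exp (-(ℓ₁ - ℓ)) with hθ
  have hθ1 : θ < 1 := by rw [hθ, Real.exp_lt_one_iff]; linarith
  have hθ0 : 0 < θ := Real.exp_pos _
  have hw : Summable fun q : ℕ => (if q < q₁ then B q else 0) + θ ^ q := by
    refine Summable.add (summable_of_hasFiniteSupport ?_)
      (summable_geometric_of_lt_one hθ0.le hθ1)
    refine (Set.finite_lt_nat q₁).subset fun q hq => ?_
    by_contra hcon
    exact hq (if_neg hcon)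
  set W := ∑' q : ℕ, ((if q < q₁ then B q else 0) + θ ^ q) with hW
  obtain ⟨r₁, _, hr₁⟩ := h.eventually_eq
  have hV : ∀ᶠ r : ℝ in atTop, W ≤ Real.exp ((A - A₁) * r ^ p' r) :=
    (Real.tendsto_exp_atTop.comp ((h.isProximateOrder.tendsto_rpow hρ).const_mul_atTop
      (sub_pos.2 hA₁A))).eventually_ge_atTop W
  filter_upwards [hV, h.isProximateOrder.eventually_mul_log_le hρ q₁ hA₁0,
    eventually_ge_atTop r₁, eventually_ge_atTop s₀, eventually_ge_atTop 1]
    with r hWr hlog hrr₁ hrs₀ hr1 x hx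
  have hr0 : 0 < r := by linarith
  rw [← hr₁ r hrr₁]
  have hterm : ∀ q, ‖homPart a q x‖
      ≤ Real.exp (A₁ * r ^ p' r) * ((if q < q₁ then B q else 0) + θ ^ q) := by
    intro q
    obtain ⟨u, hu, rfl⟩ : ∃ u : EuclideanSpace ℝ (Fin (n + 1)), ‖u‖ ≤ 1 ∧ x = r • u := by
      refine ⟨r⁻¹ • x, ?_, by rw [smul_smul, mul_inv_cancel₀ hr0.ne', one_smul]⟩
      rw [norm_smul, norm_inv, Real.norm_of_nonneg hr0.le, inv_mul_le_iff₀ hr0]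
      linarith
    rw [homPart_smul, norm_smul, norm_pow, Real.norm_of_nonneg hr0.le]
    by_cases hq : q < q₁
    · rw [if_pos hq]
      have h1 : r ^ q ≤ Real.exp (A₁ * r ^ p' r) := by
        refine (pow_le_pow_right₀ hr1 hq.le).trans ?_
        rw [← Real.rpow_natCast, rpow_eq_exp_mul_log hr0, Real.exp_le_exp]
        exact hlog
      refine mul_le_mul h1 ((hB q u hu).trans ?_) (norm_nonneg _) (Real.exp_pos _).le
      exact le_add_of_nonneg_right (by positivity)
    · rw [if_neg hq, zero_add]
      have hq' := hq₁ q (not_lt.1 hq)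
      have h1 := hs₀ q r hq'.2 hrs₀
      have h2 : θ ^ q = Real.exp (q * (-(ℓ₁ - ℓ))) := by rw [hθ, ← Real.exp_nat_mul]
      have h3 : r ^ q = Real.exp (q * Real.log r) := by
        rw [← Real.rpow_natCast, rpow_eq_exp_mul_log hr0]
      rw [h2, h3, ← Real.exp_add]
      refine (mul_le_mul_of_nonneg_left (hq'.1 u hu) (Real.exp_pos _).le).trans ?_
      rw [← Real.exp_add, Real.exp_le_exp]
      linarith
  have hsum := hw.hasSum.mul_left (Real.exp (A₁ * r ^ p' r))
  have := tsum_of_norm_bounded hsum hterm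
  rw [(hfa x).tsum_eq] at this
  refine this.trans ?_
  calc _ ≤ Real.exp (A₁ * r ^ p' r) * Real.exp ((A - A₁) * r ^ p' r) := by gcongr
    _ = _ := by rw [← Real.exp_add]; congr 1; ring

theorem exists_norm_homPart_le {f : EuclideanSpace ℝ (Fin (n + 1)) → Cl n}
    (hf : IsLeftMonogenic f)
    {a : (Fin n → ℕ) → Cl n} (hfa : ∀ x, HasSum (fun q : ℕ => homPart a q x) (f x)) (q : ℕ) :
    ∃ B : ℝ, ∀ x, ‖x‖ ≤ 1 → ‖homPart a q x‖ ≤ B := by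
  obtain ⟨M, hM⟩ := (isCompact_closedBall (0 : EuclideanSpace ℝ (Fin (n + 1)))
    1).exists_bound_of_continuousOn hf.1.continuous.continuousOn
  obtain ⟨C, _, h⟩ := exists_norm_homPart_mul_pow_le n (s := 1 / 2) (by norm_num) (by norm_num)
  refine ⟨C * M / ((1 / 2 * 1) ^ q), fun x hx => ?_⟩
  rw [le_div_iff₀ (by positivity)]
  exact h f a hf hfa 1 M one_pos (fun x hx => hM x (by simpa using hx)) q x hx

/-! ### The extended real quantities -/

theorem iSup_enorm_le_iff {g : EuclideanSpace ℝ (Fin (n + 1)) → Cl n} {r B : ℝ} :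
    (⨆ x ∈ Metric.closedBall (0 : EuclideanSpace ℝ (Fin (n + 1))) r, ‖g x‖ₑ)
      ≤ ENNReal.ofReal (Real.exp B) ↔ ∀ x, ‖x‖ ≤ r → ‖g x‖ ≤ Real.exp B := by
  simp only [iSup_le_iff, mem_closedBall_zero_iff, ← ofReal_norm,
    ENNReal.ofReal_le_ofReal_iff (Real.exp_pos B).le]

theorem log_ofReal_exp (y : ℝ) : ENNReal.log (ENNReal.ofReal (Real.exp y)) = y := by
  rw [ENNReal.log_ofReal_of_pos (Real.exp_pos y), Real.log_exp]

theorem log_le_coe_iff {κ : ℝ≥0∞} {y : ℝ} :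
    ENNReal.log κ ≤ y ↔ κ ≤ ENNReal.ofReal (Real.exp y) := by
  rw [← log_ofReal_exp, ENNReal.log_le_log_iff]

theorem inv_mul_add_le_iff {z : EReal} {d c ℓ : ℝ} (hd : 0 < d) :
    ((1 / d : ℝ) : EReal) * z + c ≤ ℓ ↔ z ≤ ((d * (ℓ - c) : ℝ) : EReal) := by
  have hd' : 0 < 1 / d := by positivity
  induction z with
  | bot => rw [EReal.coe_mul_bot_of_pos hd', EReal.bot_add]; simp only [bot_le]
  | top =>
    rw [EReal.coe_mul_top_of_pos hd', EReal.top_add_coe]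
    simp only [top_le_iff, EReal.coe_ne_top]
  | coe z =>
    norm_cast
    rw [← le_sub_iff_add_le, one_div, inv_mul_le_iff₀ hd]

theorem sub_sub_le_iff {x : EReal} {a b z : ℝ} :
    x - (a : EReal) - (b : EReal) ≤ z ↔ x ≤ ((z + a + b : ℝ) : EReal) := by
  induction x with
  | bot => simp
  | top => simp only [EReal.top_sub_coe, top_le_iff, EReal.coe_ne_top]
  | coe x =>
    norm_cast
    constructor <;> intro h <;> linarith

theorem growthType_le {f : EuclideanSpace ℝ (Fin (n + 1)) → Cl n} {A : ℝ}
    (hM : ∀ᶠ r : ℝ in atTop, ∀ x, ‖x‖ ≤ r → ‖f x‖ ≤ Real.exp (A * r ^ p r)) :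
    growthType p f ≤ ENNReal.ofReal A := by
  refine limsup_le_of_le (by isBoundedDefault) ?_
  filter_upwards [hM, eventually_gt_atTop 0] with r h hr
  have hV : 0 < r ^ p r := by positivity
  refine ENNReal.div_le_of_le_mul ?_
  rw [← ENNReal.ofReal_mul' hV.le, ← EReal.real_coe_toENNReal]
  exact EReal.toENNReal_le_toENNReal (log_le_coe_iff.2 (iSup_enorm_le_iff.2 h))

theorem eventually_norm_le_of_growthType_lt {f : EuclideanSpace ℝ (Fin (n + 1)) → Cl n} {A : ℝ}
    (hA : 0 < A) (h : growthType p f < ENNReal.ofReal A) :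
    ∀ᶠ r : ℝ in atTop, ∀ x, ‖x‖ ≤ r → ‖f x‖ ≤ Real.exp (A * r ^ p r) := by
  filter_upwards [eventually_lt_of_limsup_lt h, eventually_gt_atTop 0] with r h hr
  have hV : 0 < r ^ p r := by positivity
  rw [← iSup_enorm_le_iff, ← log_le_coe_iff]
  have h1 : (ENNReal.log (maxModulus f r)).toENNReal ≤ ENNReal.ofReal (A * r ^ p r) := by
    rw [ENNReal.ofReal_mul hA.le]
    exact (ENNReal.div_le_iff (ENNReal.ofReal_pos.2 hV).ne' ENNReal.ofReal_ne_top).1 h.le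
  -- Back in `EReal`, `toENNReal` is the maximum with `0`, so the bound on `log⁺` also bounds `log`.
  have h2 := EReal.coe_ennreal_le_coe_ennreal_iff.2 h1
  rw [EReal.coe_toENNReal_eq_max, EReal.coe_ennreal_ofReal,
    max_eq_left (show 0 ≤ A * r ^ p r by positivity)] at h2
  exact (le_max_right _ _).trans h2

/-- The type of an entire monogenic function with respect to a proximate order, in terms of the
maxima of the homogeneous parts on the unit ball. -/
theorem log_growthType_eq_limsup (hρ : 0 < ρ) (hp' : IsNormalization ρ p p')
    {f : EuclideanSpace ℝ (Fin (n + 1)) → Cl n} (hf : IsLeftMonogenic f)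
    {a : (Fin n → ℕ) → Cl n} (hfa : ∀ x, HasSum (fun q : ℕ => homPart a q x) (f x)) :
    ((1 / ρ : ℝ) : EReal) * ENNReal.log (growthType p f) =
      limsup
          (fun q : ℕ => ((1 / q : ℝ) : EReal) * ENNReal.log (homSup a q) +
            ((Real.log (inverseFn p' q) : ℝ) : EReal)) atTop
        - ((1 / ρ : ℝ) : EReal) - ((Real.log ρ / ρ : ℝ) : EReal) := by
  have hterm : ∀ (q : ℕ) (b : ℝ), 0 < q →
      (((1 / q : ℝ) : EReal) * ENNReal.log (homSup a q) +
        ((Real.log (inverseFn p' q) : ℝ) : EReal) ≤ b ↔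
      ∀ x, ‖x‖ ≤ 1 → ‖homPart a q x‖ ≤ Real.exp (q * (b - Real.log (inverseFn p' q)))) := by
    intro q b hq
    rw [inv_mul_add_le_iff (Nat.cast_pos.2 hq), log_le_coe_iff, homSup, iSup_enorm_le_iff]
  have htype : ∀ z : ℝ, ((1 / ρ : ℝ) : EReal) * ENNReal.log (growthType p f) ≤ z ↔
      growthType p f ≤ ENNReal.ofReal (Real.exp (ρ * z)) := by
    intro z
    have := inv_mul_add_le_iff (z := ENNReal.log (growthType p f)) (c := 0) (ℓ := z) hρ
    rwa [EReal.coe_zero, add_zero, sub_zero, log_le_coe_iff] at this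
  -- Testing each inequality against real upper bounds `z` covers the types `0` and `∞` without
  -- separate cases.
  refine le_antisymm (EReal.le_of_forall_lt_iff_le.1 fun z hz => ?_)
    (EReal.le_of_forall_lt_iff_le.1 fun z hz => ?_)
  · obtain ⟨z₀, hz₀, hz₀z⟩ := EReal.lt_iff_exists_real_btwn.1 hz
    obtain ⟨z₁, hz₁, hz₁z⟩ := EReal.lt_iff_exists_real_btwn.1 hz₀z
    have h1 := sub_sub_le_iff.1 hz₀.le
    rw [htype]
    -- This `ℓ` satisfies `exp (ρ ℓ - 1) / ρ = exp (ρ z₁)`, which is below `exp (ρ z)`.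
    refine growthType_le (eventually_norm_le hp' hρ hfa (exists_norm_homPart_le hf hfa)
      (ℓ := z₁ + 1 / ρ + Real.log ρ / ρ) ?_ ?_)
    · have h2 : limsup (fun q : ℕ => ((1 / q : ℝ) : EReal) * ENNReal.log (homSup a q) +
            ((Real.log (inverseFn p' q) : ℝ) : EReal)) atTop
          < ((z₁ + 1 / ρ + Real.log ρ / ρ : ℝ) : EReal) := by
        refine h1.trans_lt ?_
        norm_cast at hz₁ ⊢
        linarith
      filter_upwards [eventually_lt_of_limsup_lt h2, eventually_gt_atTop 0] with q h3 hq
      exact (hterm q _ hq).1 h3.le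
    · rw [div_lt_iff₀ hρ]
      norm_cast at hz₁z
      have : ρ * (z₁ + 1 / ρ + Real.log ρ / ρ) - 1 = ρ * z₁ + Real.log ρ := by
        field_simp; ring
      rw [this, Real.exp_add, Real.exp_log hρ]
      gcongr
  · obtain ⟨z₀, hz₀, hz₀z⟩ := EReal.lt_iff_exists_real_btwn.1 hz
    obtain ⟨z₁, hz₁, hz₁z⟩ := EReal.lt_iff_exists_real_btwn.1 hz₀z
    norm_cast at hz₁ hz₁z
    rw [sub_sub_le_iff]
    have h1 : growthType p f < ENNReal.ofReal (Real.exp (ρ * z₁)) := by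
      refine ((htype z₀).1 hz₀.le).trans_lt ?_
      rw [ENNReal.ofReal_lt_ofReal_iff (Real.exp_pos _), Real.exp_lt_exp]
      nlinarith
    refine limsup_le_of_le (by isBoundedDefault) ?_
    -- For `A = exp (ρ z₁)` the threshold `(1 + ln (A ρ)) / ρ` is `z₁ + 1/ρ + ln ρ / ρ`, below `b`
    -- since `z₁ < z`.
    filter_upwards [eventually_norm_homPart_le hp' hρ hf hfa (Real.exp_pos _)
      (eventually_norm_le_of_growthType_lt (Real.exp_pos _) h1)
      (b := z + 1 / ρ + Real.log ρ / ρ) (by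
        rw [Real.log_mul (Real.exp_pos _).ne' hρ.ne', Real.log_exp, div_lt_iff₀ hρ]
        have : (z + 1 / ρ + Real.log ρ / ρ) * ρ = z * ρ + 1 + Real.log ρ := by
          field_simp
        rw [this]
        nlinarith), eventually_gt_atTop 0] with q h3 hq
    exact (hterm q _ hq).2 h3

end MonogenicGrowth

end

theorem theorem3 (n : ℕ) (ρ : ℝ) (hρ : 0 < ρ) (p p' : ℝ → ℝ)
    (hp : MonogenicGrowth.IsProximateOrder ρ p)
    (hp' : MonogenicGrowth.IsNormalization ρ p p')
    (f : EuclideanSpace ℝ (Fin (n + 1)) → MonogenicGrowth.Cl n)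
    (hf : MonogenicGrowth.IsLeftMonogenic f)
    (a : (Fin n → ℕ) → MonogenicGrowth.Cl n)
    (hfa : ∀ x, HasSum (fun q : ℕ => MonogenicGrowth.homPart a q x) (f x)) :
    ((1 / ρ : ℝ) : EReal) * ENNReal.log (MonogenicGrowth.growthType p f) =
      Filter.limsup
          (fun q : ℕ => ((1 / q : ℝ) : EReal) * ENNReal.log (MonogenicGrowth.homSup a q) +
            ((Real.log (MonogenicGrowth.inverseFn p' q) : ℝ) : EReal))
          Filter.atTop
        - ((1 / ρ : ℝ) : EReal) - ((Real.log ρ / ρ : ℝ) : EReal) :=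
  MonogenicGrowth.log_growthType_eq_limsup hρ hp' hf hfa
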